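/- Let $(X,\mathcal X,\mu)$ be a probability space and let $T\colon X\to X$ be a measure-preserving transformation that is totally ergodic, meaning that $T^r$ is ergodic for every integer $r\ge 1$. Let $\mathcal E_0(T)$ be the set of eigenvalues of $T$ (the $c\in\mathbb C$ for which there is a nonzero $g\in L^2(\mu)$ with $g\circ T=c\,g$ a.e.), regarded as constant functions, and for $k\ge 1$ define inductively $$\mathcal E_k(T)=\{g\in L^\infty(\mu)\colon |g|=1 \text{ a.e. and } (g\circ T)\cdot\overline g\in\mathcal E_{k-1}(T)\}.$$ Write $f\in\mathcal E_k(T)^\perp$ if $\int f\,\overline g\,d\mu=0$ for every $g\in\mathcal E_k(T)$. Let $\mathbb T=\mathbb R/\mathbb Z$, and let $\mathbb R_k[t]$ be the set of real polynomials of degree at most $k$. Let $f\in L^1(\mu)$ be complex-valued and let $k\ge 1$ be an integer. Then the following three conditions are equivalent: (i) $f\in\mathcal E_k(T)^\perp$. (ii) For $\mu$-a.e. $x\in X$ we have, for every continuous $\phi\colon\mathbb T\to\mathbb C$ and every $P\in\mathbb R_k[t]$, $$\lim_{N\to\infty}\frac1N\sum_{n=1}^N\phi(P(n))\,f(T^nx)=0.$$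 (iii) For $\mu$-a.e. $x\in X$ we have, for every continuous $\phi\colon\mathbb T\to\mathbb C$, $$\lim_{N\to\infty}\ \sup_{P\in\mathbb R_k[t]}\Big|\frac1N\sum_{n=1}^N\phi(P(n))\,f(T^nx)\Big|=0.$$ The set of full measure in (ii) does not depend on $\phi$ or $P$, and in (iii) it does not depend on $\phi$. -/

import Mathlib

open MeasureTheory Filter Topology
open scoped ComplexConjugate

/-- `T` is totally ergodic: every power `T^r`, `r ≥ 1`, is measure preserving and ergodic
(Mathlib's `Ergodic` includes measure preservation). -/
def TotallyErgodic {X : Type*} [MeasurableSpace X] (T : X → X) (μ : Measure X) : Prop :=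
  ∀ r : ℕ, 1 ≤ r → Ergodic (T^[r]) μ

/-- `c` is an eigenvalue of `T`, i.e. of the Koopman operator `g ↦ g ∘ T` on `L²(μ)`. -/
def IsKoopmanEigenvalue {X : Type*} [MeasurableSpace X] (T : X → X) (μ : Measure X)
    (c : ℂ) : Prop :=
  ∃ g : X → ℂ, MemLp g 2 μ ∧ ¬ (g =ᵐ[μ] 0) ∧ ∀ᵐ x ∂μ, g (T x) = c * g x

/-- The level-`k` quasi-eigenfunctions `ℰ_k(T)`, as a set of functions closed under a.e. equality.
Level `0` consists of the eigenvalues of `T`, regarded as constant functions. -/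
def quasiEigenfunctions {X : Type*} [MeasurableSpace X] (T : X → X) (μ : Measure X) :
    ℕ → Set (X → ℂ)
  | 0 => {g | ∃ c : ℂ, IsKoopmanEigenvalue T μ c ∧ ∀ᵐ x ∂μ, g x = c}
  | k + 1 => {g | MemLp g ⊤ μ ∧ (∀ᵐ x ∂μ, ‖g x‖ = 1) ∧
      (fun x => g (T x) * conj (g x)) ∈ quasiEigenfunctions T μ k}

/-- `f ∈ ℰ_k(T)^⊥`; the integrand is integrable whenever `f ∈ L¹(μ)`, because the functions in
`ℰ_k(T)` are essentially bounded. -/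
def OrthogonalToQuasiEigenfunctions {X : Type*} [MeasurableSpace X] (T : X → X) (μ : Measure X)
    (k : ℕ) (f : X → ℂ) : Prop :=
  ∀ g ∈ quasiEigenfunctions T μ k, ∫ x, f x * conj (g x) ∂μ = 0

/-- The average `(1/N) ∑_{n=1}^N φ(P(n)) f(T^n x)`, with `𝕋 = ℝ/ℤ`. -/
noncomputable def polyAverage {X : Type*} (T : X → X) (f : X → ℂ) (φ : C(UnitAddCircle, ℂ))
    (P : Polynomial ℝ) (N : ℕ) (x : X) : ℂ :=
  (1 / (N : ℂ)) * ∑ n ∈ Finset.Icc 1 N,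
    φ ((P.eval (n : ℝ) : ℝ) : UnitAddCircle) * f (T^[n] x)

/-!
The averages against `φ(P(n))` are controlled by self-contained ergodic theory of *polynomial
phases*: unimodular functions `g` whose `k`-fold multiplicative derivative
`g ↦ (g ∘ T) * conj g` is almost everywhere constant. For `k ≥ 1` these are exactly the functions
in `ℰ_k(T)`.

**From orthogonality to uniform convergence.** Let `f` be bounded. If the averages
`(1/N) ∑ e(P_N(n)) f(T^n x)` stay away from `0` along some sequence of polynomials `P_N` of degree
at most `k`, then the empirical measures of the orbits of the pairs (orbit of `x`, sequence
`e(P_N(n))`) in the compact shift space of such pairs have a limit point `ν`. It is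
shift-invariant, projects to the factor of `X` generated by `f` because `x` is generic, and is
carried by the sequences in the circle with trivial `(k+1)`-st difference, because this is a closed
condition (`eventually_norm_average_le`). Uniformity in `P` costs nothing here, as the polynomials
may vary with `N`. By the Krein–Milman theorem it is enough to bound integrals against the extreme
points among these measures, which are ergodic (`IsConstrainedJoining.norm_integral_le_of_ergodic`).
For an ergodic measure the circle coordinate `F` is a polynomial phase of degree `k` on an ergodic
extension `p : Z → X` of a totally ergodic system, and the theorem is reduced to a statement on the
correlations of such an `F` with functions on `X`.

**The structure theorem** (`PolyPhase.exists_lift_of_integral_ne_zero`): if `F` is correlated with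
a bounded function `f` on `X`, then `F = I * (u ∘ p)` with `u` a polynomial phase of degree `k` on
`X` and `I` invariant under some power `S^r`. By van der Corput, some derivative
`(F ∘ S^m) * conj F`, of lower degree, is correlated with the bounded function
`(f ∘ T^m) * conj f` and by induction is of this form. Its invariant part has a constant power
(`PolyPhase.exists_pow_ae_eq_const`), so passing to a multiple `M` of `m` yields
`F ∘ S^M = (u' ∘ p) * F`. The projection `v` of `F` to `L²(X)` solves the same equation
`v ∘ T^M = u' * v`; hence `|v|` is constant, and total ergodicity makes `v` a multiple of a
polynomial phase for `T` itself (`PolyPhase.of_twisted_eigenfunction`). Since the projection of `I`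
to `X` is constant by total ergodicity, correlations of `f` with `F` are bounded by those with
polynomial phases on `X`.

Integrable `f` are approximated by bounded ones, with the error controlled by Birkhoff's pointwise
ergodic theorem (`Ergodic.ae_tendsto_average`), and continuous `φ` by trigonometric polynomials.

**From pointwise convergence to orthogonality.** Along almost every orbit a function `g ∈ ℰ_k(T)`
is of the form `e(P(n))` with `P` of degree at most `k` (`PolyPhase.ae_exists_choose_sum`), so that
the ergodic averages of `f * conj g`, which converge to its integral, converge to `0`.
-/

/-! ### Polynomial phases -/

/-- The polynomial phases of degree `k` of a transformation `S`: unimodular measurable functions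
whose `k`-fold multiplicative derivative `g ↦ (g ∘ S) * conj g` is almost everywhere equal to a
unimodular constant. In degree `0` any unimodular constant is allowed, not only an eigenvalue; in
degrees `k ≥ 1` this makes no difference, since then the constant is automatically an
eigenvalue. -/
def PolyPhase {Ω : Type*} [MeasurableSpace Ω] (S : Ω → Ω) (ν : Measure Ω) : ℕ → Set (Ω → ℂ)
  | 0 => {g | ∃ c : ℂ, ‖c‖ = 1 ∧ ∀ᵐ x ∂ν, g x = c}
  | k + 1 => {g | AEStronglyMeasurable g ν ∧ (∀ᵐ x ∂ν, ‖g x‖ = 1) ∧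
      (fun x => g (S x) * conj (g x)) ∈ PolyPhase S ν k}

lemma Complex.mul_conj_of_norm_one {z : ℂ} (h : ‖z‖ = 1) : z * conj z = 1 := by
  rw [Complex.mul_conj, Complex.normSq_eq_norm_sq, h]; simp

lemma Complex.conj_mul_of_norm_one {z : ℂ} (h : ‖z‖ = 1) : conj z * z = 1 := by
  rw [mul_comm, Complex.mul_conj_of_norm_one h]

namespace PolyPhase

variable {Ω : Type*} [MeasurableSpace Ω] {S : Ω → Ω} {ν : Measure Ω} {k : ℕ} {g h : Ω → ℂ}

lemma aestronglyMeasurable (hg : g ∈ PolyPhase S ν k) : AEStronglyMeasurable g ν := by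
  cases k with
  | zero =>
    obtain ⟨c, -, hc⟩ := hg
    exact aestronglyMeasurable_const.congr (Filter.EventuallyEq.symm hc)
  | succ k => exact hg.1

lemma norm_eq_one (hg : g ∈ PolyPhase S ν k) : ∀ᵐ x ∂ν, ‖g x‖ = 1 := by
  cases k with
  | zero =>
    obtain ⟨c, h1, hc⟩ := hg
    filter_upwards [hc] with x hx
    rw [hx, h1]
  | succ k => exact hg.2.1

lemma memLp [IsFiniteMeasure ν] (hg : g ∈ PolyPhase S ν k) (p : ENNReal) : MemLp g p ν :=
  MemLp.of_bound (aestronglyMeasurable hg) 1 ((norm_eq_one hg).mono fun _ hx => hx.le)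

lemma const {c : ℂ} (hc : ‖c‖ = 1) (k : ℕ) : (fun _ => c) ∈ PolyPhase S ν k := by
  induction k generalizing c with
  | zero => exact ⟨c, hc, by simp⟩
  | succ k ih =>
    refine ⟨aestronglyMeasurable_const, by simp [hc], ?_⟩
    exact ih (c := c * conj c) (by simp [hc])

lemma congr (hS : MeasurePreserving S ν ν) (hg : g ∈ PolyPhase S ν k) (hgh : g =ᵐ[ν] h) :
    h ∈ PolyPhase S ν k := by
  induction k generalizing g h with
  | zero =>
    obtain ⟨c, h1, hc⟩ := hg
    refine ⟨c, h1, ?_⟩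
    filter_upwards [hc, hgh] with x hx hx'
    rw [← hx', hx]
  | succ k ih =>
    refine ⟨hg.1.congr hgh, ?_, ih hg.2.2 ?_⟩
    · filter_upwards [hg.2.1, hgh] with x hx hx'
      rw [← hx', hx]
    · filter_upwards [hgh, hS.quasiMeasurePreserving.ae hgh] with x hx hx'
      rw [hx, hx']

/-- Polynomial phases of a factor lift to the extension. -/
lemma comp {X : Type*} [MeasurableSpace X] {T : X → X}
    {μ : Measure X} {p : Ω → X} (hp : MeasurePreserving p ν μ) (hpS : ∀ z, p (S z) = T (p z))
    {u : X → ℂ} (hu : u ∈ PolyPhase T μ k) : (fun z => u (p z)) ∈ PolyPhase S ν k := by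
  induction k generalizing u with
  | zero =>
    obtain ⟨c, h1, hc⟩ := hu
    exact ⟨c, h1, hp.quasiMeasurePreserving.ae hc⟩
  | succ k ih =>
    refine ⟨hu.1.comp_measurePreserving hp, hp.quasiMeasurePreserving.ae hu.2.1, ?_⟩
    simpa only [hpS] using ih hu.2.2

lemma comp_self (hS : MeasurePreserving S ν ν) (hg : g ∈ PolyPhase S ν k) (m : ℕ) :
    (fun x => g (S^[m] x)) ∈ PolyPhase S ν k := by
  refine comp (hS.iterate m) (fun z => ?_) hg
  rw [← Function.iterate_succ_apply, Function.iterate_succ_apply']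

lemma mul (hg : g ∈ PolyPhase S ν k) (hh : h ∈ PolyPhase S ν k) :
    (fun x => g x * h x) ∈ PolyPhase S ν k := by
  induction k generalizing g h with
  | zero =>
    obtain ⟨c, h1, hc⟩ := hg
    obtain ⟨d, h2, hd⟩ := hh
    refine ⟨c * d, by simp [h1, h2], ?_⟩
    filter_upwards [hc, hd] with x hx hx'
    rw [hx, hx']
  | succ k ih =>
    refine ⟨hg.1.mul hh.1, ?_, ?_⟩
    · filter_upwards [hg.2.1, hh.2.1] with x hx hx'
      rw [norm_mul, hx, hx', one_mul]
    · convert ih hg.2.2 hh.2.2 using 2 with x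
      simp only [map_mul]
      ring

lemma star_mem (hg : g ∈ PolyPhase S ν k) : (fun x => conj (g x)) ∈ PolyPhase S ν k := by
  induction k generalizing g with
  | zero =>
    obtain ⟨c, h1, hc⟩ := hg
    refine ⟨starRingEnd ℂ c, by simp [h1], ?_⟩
    filter_upwards [hc] with x hx
    rw [hx]
  | succ k ih =>
    refine ⟨hg.1.star, ?_, ?_⟩
    · filter_upwards [hg.2.1] with x hx
      rw [RCLike.norm_conj, hx]
    · convert ih hg.2.2 using 2 with x
      simp only [map_mul]

lemma prod {ι : Type*} (s : Finset ι) {G : ι → Ω → ℂ}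
    (hG : ∀ i ∈ s, G i ∈ PolyPhase S ν k) : (fun x => ∏ i ∈ s, G i x) ∈ PolyPhase S ν k := by
  classical
  induction s using Finset.induction_on with
  | empty => simpa using const (by simp) k
  | insert i s his ih =>
    simp only [Finset.prod_insert his]
    exact mul (hG i (by simp)) (ih fun j hj => hG j (by simp [hj]))

/-- Differentiating along a power of the map lowers the degree by one. -/
lemma iterate_mul_conj (hS : MeasurePreserving S ν ν) (hg : g ∈ PolyPhase S ν (k + 1)) (m : ℕ) :
    (fun x => g (S^[m] x) * starRingEnd ℂ (g x)) ∈ PolyPhase S ν k := by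
  induction m with
  | zero =>
    refine congr hS (const (c := 1) (by simp) k) ?_
    filter_upwards [hg.2.1] with x hx
    simp [Complex.mul_conj_of_norm_one hx]
  | succ m ih =>
    refine congr hS (mul (comp_self hS ih 1) hg.2.2) ?_
    filter_upwards [hS.quasiMeasurePreserving.ae hg.2.1] with x hx
    have := Complex.conj_mul_of_norm_one hx
    simp only [Function.iterate_succ_apply, Function.iterate_zero, id]
    linear_combination (g (S^[m] (S x)) * starRingEnd ℂ (g x)) * this

/-- A polynomial phase is invariant under a power of an ergodic map only if some power of it is
constant. -/
lemma exists_pow_ae_eq_const [IsProbabilityMeasure ν] (hS : Ergodic S ν)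
    (hg : g ∈ PolyPhase S ν k) {R : ℕ} (hR : 1 ≤ R) (hinv : ∀ᵐ x ∂ν, g (S^[R] x) = g x) :
    ∃ s : ℕ, 1 ≤ s ∧ ∃ c : ℂ, ‖c‖ = 1 ∧ ∀ᵐ x ∂ν, g x ^ s = c := by
  have hSm := hS.toMeasurePreserving
  induction k generalizing g with
  | zero =>
    obtain ⟨c, h1, hc⟩ := hg
    exact ⟨1, le_rfl, c, h1, by simpa using hc⟩
  | succ k ih =>
    obtain ⟨s, hs, c, hc, h⟩ := ih hg.2.2 (by
      filter_upwards [hinv, hSm.quasiMeasurePreserving.ae hinv] with x hx hx'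
      rw [← Function.iterate_succ_apply' S R, Function.iterate_succ_apply, hx, hx'])
    -- `g ^ s` is an eigenfunction with eigenvalue `c`
    have hstep : ∀ᵐ x ∂ν, g (S x) ^ s = c * g x ^ s := by
      filter_upwards [h, hg.2.1] with x hx hx'
      have := Complex.conj_mul_of_norm_one hx'
      calc g (S x) ^ s = (g (S x) * (starRingEnd ℂ (g x) * g x)) ^ s := by rw [this, mul_one]
        _ = (g (S x) * starRingEnd ℂ (g x)) ^ s * g x ^ s := by rw [← mul_pow, mul_assoc]
        _ = _ := by rw [hx]
    have hiter : ∀ n : ℕ, ∀ᵐ x ∂ν, g (S^[n] x) ^ s = c ^ n * g x ^ s := by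
      intro n
      induction n with
      | zero => simp
      | succ n ihn =>
        filter_upwards [hSm.quasiMeasurePreserving.ae ihn, hstep] with x hx hx'
        rw [Function.iterate_succ_apply, hx, hx']
        ring
    have hcR : c ^ R = 1 := by
      obtain ⟨x, hx, hx', hx''⟩ := ((hiter R).and (hinv.and hg.2.1)).exists
      rw [hx'] at hx
      have h0 : g x ^ s ≠ 0 := pow_ne_zero _ (by rw [← norm_ne_zero_iff, hx'']; simp)
      exact (mul_eq_right₀ h0).1 hx.symm
    have hconst := hS.ae_eq_const_of_ae_eq_comp_ae (g := fun x => g x ^ (s * R))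
      (hg.1.pow _) (by
        filter_upwards [hstep] with x hx
        simp only [Function.comp_apply, pow_mul, hx, mul_pow, hcR, one_mul])
    obtain ⟨d, hd⟩ := hconst
    refine ⟨s * R, Nat.mul_pos hs hR, d, ?_, hd⟩
    obtain ⟨x, hx, hx'⟩ := (Filter.Eventually.and hd hg.2.1).exists
    simp only [Function.const_apply] at hx
    rw [← hx, norm_pow, hx', one_pow]

/-- Over a totally ergodic map, solutions of a twisted eigenvalue equation for a power of the map
are polynomial phases for the map itself. -/
lemma of_twisted_eigenfunction [IsProbabilityMeasure ν] (hS : TotallyErgodic S ν) {w u : Ω → ℂ}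
    {M : ℕ} (hM : 1 ≤ M) (hw : AEStronglyMeasurable w ν) (hw1 : ∀ᵐ x ∂ν, ‖w x‖ = 1)
    (hu : u ∈ PolyPhase S ν k) (hwu : ∀ᵐ x ∂ν, w (S^[M] x) = u x * w x) :
    w ∈ PolyPhase S ν (k + 1) := by
  have hSm : MeasurePreserving S ν ν := (hS 1 le_rfl).toMeasurePreserving
  suffices hΔ : (fun x => w (S x) * starRingEnd ℂ (w x)) ∈ PolyPhase S ν k from ⟨hw, hw1, hΔ⟩
  have hΔm : AEStronglyMeasurable (fun x => w (S x) * starRingEnd ℂ (w x)) ν :=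
    (hw.comp_measurePreserving hSm).mul hw.star
  have hΔ1 : ∀ᵐ x ∂ν, ‖w (S x) * starRingEnd ℂ (w x)‖ = 1 := by
    filter_upwards [hw1, hSm.quasiMeasurePreserving.ae hw1] with x hx hx'
    simp [hx, hx']
  have hΔ : ∀ᵐ x ∂ν, w (S (S^[M] x)) * starRingEnd ℂ (w (S^[M] x)) =
      (u (S x) * starRingEnd ℂ (u x)) * (w (S x) * starRingEnd ℂ (w x)) := by
    filter_upwards [hwu, hSm.quasiMeasurePreserving.ae hwu] with x hx hx'
    rw [← Function.iterate_succ_apply' S M, Function.iterate_succ_apply, hx, hx', map_mul]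
    ring
  induction k generalizing w u with
  | zero =>
    obtain ⟨c, hc, hcu⟩ := hu
    obtain ⟨d, hd⟩ := (hS M hM).ae_eq_const_of_ae_eq_comp_ae hΔm (by
      filter_upwards [hΔ, hcu, hSm.quasiMeasurePreserving.ae hcu] with x hx h1 h2
      simp only [Function.comp_apply, hx, h1, h2, Complex.mul_conj_of_norm_one hc, one_mul])
    refine ⟨d, ?_, hd⟩
    obtain ⟨x, hx, hx'⟩ := (Filter.Eventually.and hd hΔ1).exists
    rw [← hx']
    exact congrArg norm hx.symm
  | succ k ih =>
    refine ⟨hΔm, hΔ1, ih hΔm hΔ1 hu.2.2 hΔ ?_ ?_ ?_⟩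
    · exact (hΔm.comp_measurePreserving hSm).mul hΔm.star
    · filter_upwards [hΔ1, hSm.quasiMeasurePreserving.ae hΔ1] with x hx hx'
      rw [norm_mul, RCLike.norm_conj, hx, hx', one_mul]
    · filter_upwards [hΔ, hSm.quasiMeasurePreserving.ae hΔ] with x hx hx'
      simp only [← Function.iterate_succ_apply' S M, Function.iterate_succ_apply] at hx hx' ⊢
      rw [hx, hx', map_mul]
      ring

end PolyPhase

/-! ### Van der Corput's lemma and projections to a factor -/

lemma MeasureTheory.MeasurePreserving.integral_comp_ae {Ω X E : Type*} [MeasurableSpace Ω]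
    [MeasurableSpace X] [NormedAddCommGroup E] [NormedSpace ℝ E] {ν : Measure Ω} {μ : Measure X}
    {p : Ω → X} (hp : MeasurePreserving p ν μ) {f : X → E} (hf : AEStronglyMeasurable f μ) :
    ∫ z, f (p z) ∂ν = ∫ x, f x ∂μ := by
  rw [← hp.map_eq, integral_map hp.aemeasurable (hp.map_eq ▸ hf)]

/-- Van der Corput's lemma in its qualitative form: a bounded function with nonzero integral is
correlated with one of its iterates, since orthogonal iterates would have averages tending
to zero in `L²`. -/
lemma exists_integral_iterate_mul_conj_ne_zero {Ω : Type*} [MeasurableSpace Ω] {S : Ω → Ω}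
    {ν : Measure Ω} [IsProbabilityMeasure ν] (hS : MeasurePreserving S ν ν) {φ : Ω → ℂ}
    (hφ : AEStronglyMeasurable φ ν) {C : ℝ} (hC : ∀ᵐ x ∂ν, ‖φ x‖ ≤ C) (h : ∫ x, φ x ∂ν ≠ 0) :
    ∃ m : ℕ, 1 ≤ m ∧ ∫ x, φ (S^[m] x) * conj (φ x) ∂ν ≠ 0 := by
  by_contra! hcon
  have hm : ∀ n : ℕ, AEStronglyMeasurable (fun x => φ (S^[n] x)) ν := fun n =>
    hφ.comp_measurePreserving (hS.iterate n)
  have hb : ∀ n : ℕ, ∀ᵐ x ∂ν, ‖φ (S^[n] x)‖ ≤ C := fun n =>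
    (hS.iterate n).quasiMeasurePreserving.ae hC
  have hint : ∀ n m : ℕ, Integrable (fun x => φ (S^[n] x) * conj (φ (S^[m] x))) ν := by
    intro n m
    refine Integrable.of_bound ((hm n).mul (hm m).star) (C * C) ?_
    filter_upwards [hb n, hb m] with x hx hx'
    rw [norm_mul, RCLike.norm_conj]
    exact mul_le_mul hx hx' (norm_nonneg _) ((norm_nonneg _).trans hx)
  have hint1 : ∀ n : ℕ, Integrable (fun x => φ (S^[n] x)) ν := fun n =>
    Integrable.of_bound (hm n) C (hb n)
  set c := ∫ x, φ x ∂ν with hc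
  have hcn : ∀ n : ℕ, ∫ x, φ (S^[n] x) ∂ν = c := fun n =>
    (hS.iterate n).integral_comp_ae hφ
  have hgt : ∀ n m : ℕ, m < n → ∫ x, φ (S^[n] x) * conj (φ (S^[m] x)) ∂ν = 0 := by
    intro n m hmn
    obtain ⟨d, rfl⟩ := Nat.exists_eq_add_of_lt hmn
    rw [← hcon (d + 1) (by omega), ← (hS.iterate m).integral_comp_ae (f := fun x =>
      φ (S^[d + 1] x) * conj (φ x)) ((hm _).mul hφ.star)]
    refine integral_congr_ae (Eventually.of_forall fun x => ?_)
    simp only [← Function.iterate_add_apply, show d + 1 + m = m + d + 1 by omega]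
  have hne : ∀ n m : ℕ, n ≠ m → ∫ x, φ (S^[n] x) * conj (φ (S^[m] x)) ∂ν = 0 := by
    intro n m hnm
    rcases lt_or_gt_of_ne hnm with h1 | h1
    · rw [← map_eq_zero (starRingEnd ℂ), ← integral_conj, ← hgt m n h1]
      congr 1; ext x; simp [mul_comm]
    · exact hgt n m h1
  set D := ∫ x, φ x * conj (φ x) ∂ν with hD
  have hdiag : ∀ n : ℕ, ∫ x, φ (S^[n] x) * conj (φ (S^[n] x)) ∂ν = D := fun n =>
    (hS.iterate n).integral_comp_ae (f := fun x => φ x * conj (φ x)) (hφ.mul hφ.star)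
  -- the variance of a sum of `H` orthogonal iterates is nonnegative
  have key : ∀ H : ℕ, (H : ℝ) ^ 2 * ‖c‖ ^ 2 ≤ H * D.re := by
    intro H
    have hA : ∫ x, (∑ n ∈ Finset.range H, φ (S^[n] x) - H * c) *
        conj (∑ n ∈ Finset.range H, φ (S^[n] x) - H * c) ∂ν = H * D - H ^ 2 * (c * conj c) := by
      have : ∀ x, (∑ n ∈ Finset.range H, φ (S^[n] x) - H * c) *
        conj (∑ n ∈ Finset.range H, φ (S^[n] x) - H * c) =
        (∑ n ∈ Finset.range H, ∑ m ∈ Finset.range H, φ (S^[n] x) * conj (φ (S^[m] x)))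
        - (∑ n ∈ Finset.range H, φ (S^[n] x)) * (H * conj c)
        - (H * c) * conj (∑ n ∈ Finset.range H, φ (S^[n] x)) + H ^ 2 * (c * conj c) := by
        intro x
        rw [← Finset.sum_mul_sum, ← map_sum]
        simp only [map_sub, map_mul, map_natCast]
        ring
      simp_rw [this]
      have i1 : Integrable (fun x => ∑ n ∈ Finset.range H, φ (S^[n] x)) ν :=
        integrable_finsetSum _ fun n _ => hint1 n
      have i1' : Integrable (fun x => conj (∑ n ∈ Finset.range H, φ (S^[n] x))) ν :=
        (LinearIsometryEquiv.integrable_comp_iff Complex.conjLIE).2 i1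
      have i2 : Integrable (fun x => ∑ n ∈ Finset.range H, ∑ m ∈ Finset.range H,
          φ (S^[n] x) * conj (φ (S^[m] x))) ν :=
        integrable_finsetSum _ fun n _ => integrable_finsetSum _ fun m _ => hint n m
      have e1 : ∫ x, ∑ n ∈ Finset.range H, φ (S^[n] x) ∂ν = H * c := by
        rw [integral_finsetSum _ fun n _ => hint1 n]
        simp [hcn]
      have e2 : ∫ x, ∑ n ∈ Finset.range H, ∑ m ∈ Finset.range H,
          φ (S^[n] x) * conj (φ (S^[m] x)) ∂ν = H * D := by
        rw [integral_finsetSum _ fun n _ => integrable_finsetSum _ fun m _ => hint n m]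
        have : ∀ n ∈ Finset.range H, ∫ x, ∑ m ∈ Finset.range H,
          φ (S^[n] x) * conj (φ (S^[m] x)) ∂ν = D := by
          intro n hn
          rw [integral_finsetSum _ fun m _ => hint n m, Finset.sum_eq_single n, hdiag]
          · intro m _ hmn
            exact hne n m hmn.symm
          · exact fun h => absurd hn h
        rw [Finset.sum_congr rfl this]
        simp
      have j1 := i1.mul_const (H * conj c)
      have j2 := i1'.const_mul (H * c)
      have j3 : Integrable (fun x =>
          (∑ n ∈ Finset.range H, ∑ m ∈ Finset.range H, φ (S^[n] x) * conj (φ (S^[m] x)))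
          - (∑ n ∈ Finset.range H, φ (S^[n] x)) * (H * conj c)) ν := i2.sub j1
      have j4 : Integrable (fun x =>
          (∑ n ∈ Finset.range H, ∑ m ∈ Finset.range H, φ (S^[n] x) * conj (φ (S^[m] x)))
          - (∑ n ∈ Finset.range H, φ (S^[n] x)) * (H * conj c)
          - (H * c) * conj (∑ n ∈ Finset.range H, φ (S^[n] x))) ν := j3.sub j2
      rw [integral_add j4 (integrable_const _), integral_sub j3 j2,
        integral_sub i2 j1, integral_mul_const, integral_const_mul, integral_conj, e1, e2]
      simp
      ring
    have hnn : 0 ≤ (∫ x, (∑ n ∈ Finset.range H, φ (S^[n] x) - H * c) *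
        conj (∑ n ∈ Finset.range H, φ (S^[n] x) - H * c) ∂ν).re := by
      simp_rw [Complex.mul_conj]
      rw [integral_complex_ofReal, Complex.ofReal_re]
      exact integral_nonneg fun x => Complex.normSq_nonneg _
    rw [hA, Complex.mul_conj, Complex.normSq_eq_norm_sq] at hnn
    have : ((H : ℂ) * D - (H : ℂ) ^ 2 * ((‖c‖ ^ 2 : ℝ) : ℂ)).re =
        H * D.re - (H : ℝ) ^ 2 * ‖c‖ ^ 2 := by
      have : ((H : ℂ) ^ 2 * ((‖c‖ ^ 2 : ℝ) : ℂ)) = (((H : ℝ) ^ 2 * ‖c‖ ^ 2 : ℝ) : ℂ) := by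
        push_cast; ring
      rw [Complex.sub_re, this, Complex.ofReal_re]
      simp
    linarith
  have hpos : 0 < ‖c‖ ^ 2 := by positivity
  obtain ⟨H, hH⟩ := exists_nat_gt (D.re / ‖c‖ ^ 2)
  have h1 := key (H + 1)
  rw [div_lt_iff₀ hpos] at hH
  have h2 : ((H + 1 : ℕ) : ℝ) * ((H + 1 : ℕ) * ‖c‖ ^ 2) ≤ ((H + 1 : ℕ) : ℝ) * D.re := by
    linarith
  have h3 := le_of_mul_le_mul_left h2 (by positivity)
  push_cast at h3
  linarith

/-- The projection of a square-integrable function to a factor: the adjoint of the composition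
operator of the factor map, applied to that function. -/
lemma exists_factor_projection {Ω X : Type*} [MeasurableSpace Ω] [MeasurableSpace X]
    {ν : Measure Ω} {μ : Measure X} {p : Ω → X} (hp : MeasurePreserving p ν μ) {F : Ω → ℂ}
    (hF : MemLp F 2 ν) :
    ∃ v : X → ℂ, MemLp v 2 μ ∧ ∀ h : X → ℂ, MemLp h 2 μ →
      ∫ x, h x * conj (v x) ∂μ = ∫ z, h (p z) * conj (F z) ∂ν := by
  let U : Lp ℂ 2 μ →L[ℂ] Lp ℂ 2 ν := (Lp.compMeasurePreservingₗᵢ ℂ p hp).toContinuousLinearMap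
  let v : Lp ℂ 2 μ := U.adjoint hF.toLp
  refine ⟨v, Lp.memLp v, fun h hh => ?_⟩
  have h1 := ContinuousLinearMap.adjoint_inner_left U hh.toLp hF.toLp
  rw [L2.inner_def, L2.inner_def] at h1
  have e1 : ∫ x, h x * conj (v x) ∂μ = ∫ x, inner ℂ (v x) ((hh.toLp : X → ℂ) x) ∂μ := by
    refine integral_congr_ae ?_
    filter_upwards [hh.coeFn_toLp] with x hx
    rw [hx]
    rfl
  have e2 : ∫ z, h (p z) * conj (F z) ∂ν =
      ∫ z, inner ℂ ((hF.toLp : Ω → ℂ) z) ((U hh.toLp : Ω → ℂ) z) ∂ν := by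
    refine integral_congr_ae ?_
    have : (U hh.toLp : Ω → ℂ) =ᵐ[ν] fun z => h (p z) := by
      refine (Lp.coeFn_compMeasurePreserving hh.toLp hp).trans ?_
      exact hp.quasiMeasurePreserving.ae hh.coeFn_toLp
    filter_upwards [hF.coeFn_toLp, this] with x hx hx'
    rw [hx, hx']
    rfl
  rw [e1, e2]
  exact h1

/-! ### Polynomial phases on ergodic extensions of totally ergodic systems -/

/-- If `F` satisfies a twisted eigenvalue equation over the base, then so does its projection to
the base. This is the fact that a vector fixed by the adjoint of an isometry is fixed by the
isometry. -/
lemma factor_projection_iterate {Ω X : Type*} [MeasurableSpace Ω] [MeasurableSpace X]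
    {ν : Measure Ω} {μ : Measure X} {p : Ω → X} (hp : MeasurePreserving p ν μ)
    {S : Ω → Ω} {T : X → X} (hS : MeasurePreserving S ν ν) (hT : MeasurePreserving T μ μ)
    (hpS : ∀ z, p (S z) = T (p z)) {F : Ω → ℂ} (hF : MemLp F 2 ν)
    {u : X → ℂ} (hu : AEStronglyMeasurable u μ) (hu1 : ∀ᵐ x ∂μ, ‖u x‖ = 1)
    (hFu : ∀ᵐ z ∂ν, F (S z) = u (p z) * F z) {v : X → ℂ} (hv : MemLp v 2 μ)
    (hvF : ∀ h : X → ℂ, MemLp h 2 μ →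
      ∫ x, h x * conj (v x) ∂μ = ∫ z, h (p z) * conj (F z) ∂ν) :
    ∀ᵐ x ∂μ, v (T x) = u x * v x := by
  have hvT : MemLp (fun x => v (T x)) 2 μ := hv.comp_measurePreserving hT
  have huv : MemLp (fun x => u x * v x) 2 μ := by
    refine hv.of_le (hu.mul hv.1) ?_
    filter_upwards [hu1] with x hx
    simp [hx]
  have hw : MemLp (fun x => v (T x) * conj (u x)) 2 μ := by
    refine hvT.of_le (hvT.1.mul hu.star) ?_
    filter_upwards [hu1] with x hx
    simp [hx]
  have hmul : ∀ {a b : X → ℂ}, MemLp a 2 μ → MemLp b 2 μ →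
      Integrable (fun x => a x * conj (b x)) μ := by
    intro a b ha hb
    have hb' : MemLp (fun x => conj (b x)) 2 μ := hb.star
    exact MemLp.integrable_mul (p := 2) (q := 2) ha hb'
  set D := ∫ x, v x * conj (v x) ∂μ with hD
  have hDconj : conj D = D := by
    rw [hD, ← integral_conj]
    congr 1; ext x; simp [mul_comm]
  have e1 : ∫ x, v (T x) * conj (v (T x)) ∂μ = D :=
    hT.integral_comp_ae (f := fun x => v x * conj (v x)) (hv.1.mul hv.1.star)
  have e2 : ∫ x, (u x * v x) * conj (u x * v x) ∂μ = D := by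
    refine integral_congr_ae ?_
    filter_upwards [hu1] with x hx
    have := Complex.mul_conj_of_norm_one hx
    rw [map_mul]
    linear_combination (v x * conj (v x)) * this
  have e3 : ∫ x, v (T x) * conj (u x * v x) ∂μ = D := by
    calc ∫ x, v (T x) * conj (u x * v x) ∂μ = ∫ x, (v (T x) * conj (u x)) * conj (v x) ∂μ := by
          congr 1; ext x; rw [map_mul, mul_assoc]
      _ = ∫ z, (v (T (p z)) * conj (u (p z))) * conj (F z) ∂ν := hvF _ hw
      _ = ∫ z, v (p (S z)) * conj (F (S z)) ∂ν := by
          refine integral_congr_ae ?_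
          filter_upwards [hFu] with z hz
          rw [hz, hpS, map_mul, mul_assoc]
      _ = ∫ z, v (p z) * conj (F z) ∂ν :=
          hS.integral_comp_ae (f := fun z => v (p z) * conj (F z))
            ((hv.1.comp_measurePreserving hp).mul hF.1.star)
      _ = D := (hvF v hv).symm
  have e4 : ∫ x, (u x * v x) * conj (v (T x)) ∂μ = D := by
    rw [← hDconj, ← e3, ← integral_conj]
    congr 1; ext x; simp [mul_comm]
  have hsub : MemLp (fun x => v (T x) - u x * v x) 2 μ := hvT.sub huv
  -- all four terms in the expansion of `‖v ∘ T - u * v‖²` equal `‖v‖²`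
  have hzero : ∫ x, (v (T x) - u x * v x) * conj (v (T x) - u x * v x) ∂μ = 0 := by
    have : ∀ x, (v (T x) - u x * v x) * conj (v (T x) - u x * v x) =
        (v (T x) * conj (v (T x)) - v (T x) * conj (u x * v x)) -
        ((u x * v x) * conj (v (T x)) - (u x * v x) * conj (u x * v x)) := by
      intro x; rw [map_sub]; ring
    simp_rw [this]
    have j1 : Integrable (fun x => v (T x) * conj (v (T x)) - v (T x) * conj (u x * v x)) μ :=
      (hmul hvT hvT).sub (hmul hvT huv)
    have j2 : Integrable (fun x =>
        (u x * v x) * conj (v (T x)) - (u x * v x) * conj (u x * v x)) μ :=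
      (hmul huv hvT).sub (hmul huv huv)
    rw [integral_sub j1 j2, integral_sub (hmul hvT hvT) (hmul hvT huv),
      integral_sub (hmul huv hvT) (hmul huv huv), e1, e2, e3, e4]
    simp
  have hint := hmul hsub hsub
  simp_rw [Complex.mul_conj] at hzero hint
  rw [integral_complex_ofReal, Complex.ofReal_eq_zero] at hzero
  have hint' : Integrable (fun x => Complex.normSq (v (T x) - u x * v x)) μ := by
    simpa using hint.re
  rw [integral_eq_zero_iff_of_nonneg (fun x => Complex.normSq_nonneg _) hint'] at hzero
  filter_upwards [hzero] with x hx
  exact sub_eq_zero.1 (Complex.normSq_eq_zero.1 hx)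

lemma Ergodic.exists_norm_ae_eq_const {X : Type*} [MeasurableSpace X] {μ : Measure X}
    [IsProbabilityMeasure μ] {T : X → X} (hT : Ergodic T μ) {u v : X → ℂ}
    (hv : AEStronglyMeasurable v μ) (hu1 : ∀ᵐ x ∂μ, ‖u x‖ = 1)
    (h : ∀ᵐ x ∂μ, v (T x) = u x * v x) : ∃ r : ℝ, ∀ᵐ x ∂μ, ‖v x‖ = r := by
  refine hT.ae_eq_const_of_ae_eq_comp_ae hv.norm ?_
  filter_upwards [h, hu1] with x hx hx'
  simp [hx, hx']

/-- The key structure theorem: a polynomial phase on an ergodic extension of a totally ergodic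
system which is not orthogonal to the bounded functions on the base is the lift of a polynomial
phase on the base, up to a factor which is invariant under some power of the map. -/
theorem PolyPhase.exists_lift_of_integral_ne_zero {Ω X : Type*} [MeasurableSpace Ω]
    [MeasurableSpace X] {ν : Measure Ω} {μ : Measure X} [IsProbabilityMeasure ν]
    [IsProbabilityMeasure μ] {p : Ω → X} (hp : MeasurePreserving p ν μ)
    {S : Ω → Ω} {T : X → X} (hS : Ergodic S ν) (hT : TotallyErgodic T μ)
    (hpS : ∀ z, p (S z) = T (p z)) {k : ℕ} {F : Ω → ℂ} (hF : F ∈ PolyPhase S ν k)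
    {f : X → ℂ} (hf : AEStronglyMeasurable f μ) {C : ℝ} (hC : ∀ᵐ x ∂μ, ‖f x‖ ≤ C)
    (hne : ∫ z, f (p z) * conj (F z) ∂ν ≠ 0) :
    ∃ u ∈ PolyPhase T μ k, ∃ r : ℕ, 1 ≤ r ∧
      ∀ᵐ z ∂ν, F (S^[r] z) * conj (u (p (S^[r] z))) = F z * conj (u (p z)) := by
  have hSm := hS.toMeasurePreserving
  have hTm : MeasurePreserving T μ μ := (hT 1 le_rfl).toMeasurePreserving
  have hpSn : ∀ n z, p (S^[n] z) = T^[n] (p z) := by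
    intro n
    induction n with
    | zero => simp
    | succ n ih => intro z; rw [Function.iterate_succ_apply, ih, hpS, Function.iterate_succ_apply]
  induction k generalizing F f C with
  | zero =>
    obtain ⟨c, hc1, hc⟩ := hF
    refine ⟨fun _ => 1, ⟨1, by simp, by simp⟩, 1, le_rfl, ?_⟩
    filter_upwards [hc, hSm.quasiMeasurePreserving.ae hc] with z hz hz'
    simp [hz, hz']
  | succ k ih =>
    have hF1 := hF.2.1
    have hfp : AEStronglyMeasurable (fun z => f (p z)) ν := hf.comp_measurePreserving hp
    -- van der Corput reduces the degree by one
    obtain ⟨m, hm, hmne⟩ := exists_integral_iterate_mul_conj_ne_zero hSm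
      (φ := fun z => f (p z) * conj (F z)) (hfp.mul hF.1.star) (C := C) (by
        filter_upwards [hp.quasiMeasurePreserving.ae hC, hF1] with z hz hz'
        simpa [hz'] using hz) hne
    obtain ⟨u, hu, r, hr, hur⟩ := ih (F := fun z => F (S^[m] z) * conj (F z))
      (f := fun x => f (T^[m] x) * conj (f x)) (C := C * C)
      (PolyPhase.iterate_mul_conj hSm hF m)
      ((hf.comp_measurePreserving (hTm.iterate m)).mul hf.star) (by
        filter_upwards [hC, (hTm.iterate m).quasiMeasurePreserving.ae hC] with x hx hx'
        rw [norm_mul, RCLike.norm_conj]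
        exact mul_le_mul hx' hx (norm_nonneg _) ((norm_nonneg _).trans hx)) (by
        convert hmne using 2
        ext z
        simp only [map_mul, hpSn, Complex.conj_conj]
        ring)
    set I : Ω → ℂ := fun z => (F (S^[m] z) * conj (F z)) * conj (u (p z)) with hI
    have hup : (fun z => u (p z)) ∈ PolyPhase S ν k := PolyPhase.comp hp hpS hu
    have hIP : I ∈ PolyPhase S ν k :=
      PolyPhase.mul (PolyPhase.iterate_mul_conj hSm hF m) (PolyPhase.star_mem hup)
    obtain ⟨s, hs, c, hc1, hc⟩ := PolyPhase.exists_pow_ae_eq_const hS hIP hr hur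
    -- along a suitable multiple `M` of `m` the factor `I` disappears
    set M := m * (r * s) with hM
    have hM1 : 1 ≤ M := Nat.mul_pos hm (Nat.mul_pos hr hs)
    have hstep : ∀ᵐ z ∂ν, F (S^[m] z) = I z * u (p z) * F z := by
      filter_upwards [hF1, PolyPhase.norm_eq_one hup] with z h1 h2
      have h1' := Complex.conj_mul_of_norm_one h1
      have h2' := Complex.conj_mul_of_norm_one h2
      simp only [hI]
      calc F (S^[m] z) = F (S^[m] z) * (conj (F z) * F z) * (conj (u (p z)) * u (p z)) := by
            rw [h1', h2', mul_one, mul_one]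
        _ = _ := by ring
    have hprod : ∀ n : ℕ, ∀ᵐ z ∂ν, F (S^[m * n] z) =
        (∏ j ∈ Finset.range n, I (S^[m * j] z)) *
          (∏ j ∈ Finset.range n, u (T^[m * j] (p z))) * F z := by
      intro n
      induction n with
      | zero => simp
      | succ n ihn =>
        filter_upwards [ihn, (hSm.iterate (m * n)).quasiMeasurePreserving.ae hstep] with z h1 h2
        rw [Finset.prod_range_succ, Finset.prod_range_succ, show m * (n + 1) = m + m * n by ring,
          Function.iterate_add_apply, h2, h1, hpSn]
        ring
    have hIr : ∀ n : ℕ, ∀ᵐ z ∂ν, I (S^[r * n] z) = I z := by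
      intro n
      induction n with
      | zero => simp
      | succ n ihn =>
        filter_upwards [ihn, (hSm.iterate (r * n)).quasiMeasurePreserving.ae hur] with z h1 h2
        rw [show r * (n + 1) = r + r * n by ring, Function.iterate_add_apply]
        exact h2.trans h1
    -- over `r * s` factors, each of the `r` translates of `I` occurs `s` times
    have hIprod : ∀ᵐ z ∂ν, ∏ j ∈ Finset.range (r * s), I (S^[m * j] z) =
        ∏ j ∈ Finset.range r, c := by
      have h1 : ∀ᵐ z ∂ν, ∀ j i : ℕ, I (S^[m * (j + r * i)] z) = I (S^[m * j] z) := by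
        rw [ae_all_iff]; intro j; rw [ae_all_iff]; intro i
        filter_upwards [(hSm.iterate (m * j)).quasiMeasurePreserving.ae (hIr (m * i))] with z hz
        rw [← hz, ← Function.iterate_add_apply]
        congr 3; ring
      have h2 : ∀ᵐ z ∂ν, ∀ j : ℕ, I (S^[m * j] z) ^ s = c := by
        rw [ae_all_iff]; intro j
        exact (hSm.iterate (m * j)).quasiMeasurePreserving.ae hc
      filter_upwards [h1, h2] with z h1 h2
      have : ∀ t : ℕ, ∏ j ∈ Finset.range (r * t), I (S^[m * j] z) =
          ∏ j ∈ Finset.range r, I (S^[m * j] z) ^ t := by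
        intro t
        induction t with
        | zero => simp
        | succ t iht =>
          rw [Nat.mul_succ, Finset.prod_range_add, iht, ← Finset.prod_mul_distrib]
          refine Finset.prod_congr rfl fun j _ => ?_
          rw [add_comm, h1, pow_succ]
      rw [this s]
      exact Finset.prod_congr rfl fun j _ => h2 j
    set u' : X → ℂ := fun x => (∏ j ∈ Finset.range r, c) *
      ∏ j ∈ Finset.range (r * s), u (T^[m * j] x) with hu'
    have hu'P : u' ∈ PolyPhase T μ k :=
      PolyPhase.mul (PolyPhase.const (by simp [hc1]) k)
        (PolyPhase.prod _ fun j _ => PolyPhase.comp_self hTm hu (m * j))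
    have hFM : ∀ᵐ z ∂ν, F (S^[M] z) = u' (p z) * F z := by
      filter_upwards [hprod (r * s), hIprod] with z h1 h2
      rw [hM, h1, h2]
    -- the projection of `F` to the base satisfies the same equation
    have hFL := PolyPhase.memLp hF 2
    obtain ⟨v, hv, hvF⟩ := exists_factor_projection hp hFL
    have hvM := factor_projection_iterate hp (hSm.iterate M) (hTm.iterate M) (hpSn M) hFL
      (PolyPhase.aestronglyMeasurable hu'P) (PolyPhase.norm_eq_one hu'P) hFM hv hvF
    obtain ⟨ρ, hρ⟩ := Ergodic.exists_norm_ae_eq_const (hT M hM1) hv.1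
      (PolyPhase.norm_eq_one hu'P) hvM
    have hρ0 : ρ ≠ 0 := by
      rintro rfl
      apply hne
      rw [← hvF f (MemLp.of_bound hf C hC)]
      rw [integral_congr_ae (g := fun _ => 0), integral_zero]
      filter_upwards [hρ] with x hx
      rw [norm_eq_zero.1 hx]; simp
    have hw : (fun x => (ρ : ℂ)⁻¹ * v x) ∈ PolyPhase T μ (k + 1) := by
      refine PolyPhase.of_twisted_eigenfunction hT hM1 (hv.1.const_mul _) ?_ hu'P ?_
      · filter_upwards [hρ] with x hx
        have : 0 ≤ ρ := hx ▸ norm_nonneg _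
        rw [norm_mul, hx, norm_inv, Complex.norm_real, Real.norm_of_nonneg this,
          inv_mul_cancel₀ hρ0]
      · filter_upwards [hvM] with x hx
        rw [hx]; ring
    refine ⟨_, hw, M, hM1, ?_⟩
    filter_upwards [hFM, hp.quasiMeasurePreserving.ae hvM,
      hp.quasiMeasurePreserving.ae (PolyPhase.norm_eq_one hu'P)] with z h1 h2 h3
    have h3' := Complex.mul_conj_of_norm_one h3
    rw [h1, hpSn, h2]
    simp only [map_mul]
    linear_combination (F z * (conj (ρ : ℂ)⁻¹ * conj (v (p z)))) * h3'

/-- Polynomial phases on an ergodic extension are not better correlated with a bounded function on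
the totally ergodic base than the polynomial phases on the base. -/
theorem PolyPhase.norm_integral_le_of_extension {Ω X : Type*} [MeasurableSpace Ω]
    [MeasurableSpace X] {ν : Measure Ω} {μ : Measure X} [IsProbabilityMeasure ν]
    [IsProbabilityMeasure μ] {p : Ω → X} (hp : MeasurePreserving p ν μ)
    {S : Ω → Ω} {T : X → X} (hS : Ergodic S ν) (hT : TotallyErgodic T μ)
    (hpS : ∀ z, p (S z) = T (p z)) {k : ℕ} {F : Ω → ℂ} (hF : F ∈ PolyPhase S ν k)
    {f : X → ℂ} (hf : AEStronglyMeasurable f μ) {C : ℝ} (hC : ∀ᵐ x ∂μ, ‖f x‖ ≤ C)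
    {ε : ℝ} (hε : 0 ≤ ε) (hfu : ∀ u ∈ PolyPhase T μ k, ‖∫ x, f x * conj (u x) ∂μ‖ ≤ ε) :
    ‖∫ z, f (p z) * conj (F z) ∂ν‖ ≤ ε := by
  have hSm := hS.toMeasurePreserving
  have hTm : MeasurePreserving T μ μ := (hT 1 le_rfl).toMeasurePreserving
  by_cases hne : ∫ z, f (p z) * conj (F z) ∂ν = 0
  · rw [hne]; simpa using hε
  obtain ⟨u, hu, r, hr, hur⟩ :=
    PolyPhase.exists_lift_of_integral_ne_zero hp hS hT hpS hF hf hC hne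
  have hup : (fun z => u (p z)) ∈ PolyPhase S ν k := PolyPhase.comp hp hpS hu
  have hpSn : ∀ n z, p (S^[n] z) = T^[n] (p z) := by
    intro n
    induction n with
    | zero => simp
    | succ n ih => intro z; rw [Function.iterate_succ_apply, ih, hpS, Function.iterate_succ_apply]
  set I : Ω → ℂ := fun z => F z * conj (u (p z)) with hI
  have hIP : I ∈ PolyPhase S ν k := PolyPhase.mul hF (PolyPhase.star_mem hup)
  have hIL := PolyPhase.memLp hIP 2
  obtain ⟨v, hv, hvI⟩ := exists_factor_projection hp hIL
  have hvr := factor_projection_iterate hp (hSm.iterate r) (hTm.iterate r) (hpSn r) hIL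
    (u := fun _ => 1) aestronglyMeasurable_const (by simp) (by simpa using hur) hv hvI
  -- the projection of `I` to the base is invariant, hence constant
  obtain ⟨c, hc⟩ := (hT r hr).ae_eq_const_of_ae_eq_comp_ae hv.1 (by
    filter_upwards [hvr] with x hx
    simpa using hx)
  have hc1 : ‖conj c‖ ≤ 1 := by
    have h1 := hvI (fun _ => 1) (memLp_const 1)
    simp only [one_mul] at h1
    rw [integral_congr_ae (g := fun _ => conj c) (by
      filter_upwards [hc] with x hx; rw [hx]; rfl)] at h1
    simp only [integral_const, probReal_univ, one_smul] at h1
    rw [h1]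
    refine (norm_integral_le_of_norm_le_const (C := 1) ?_).trans (by simp)
    filter_upwards [PolyPhase.norm_eq_one hIP] with z hz
    simp [hz]
  have hfuL : MemLp (fun x => f x * conj (u x)) 2 μ := by
    refine MemLp.of_bound (hf.mul (PolyPhase.aestronglyMeasurable hu).star) C ?_
    filter_upwards [hC, PolyPhase.norm_eq_one hu] with x hx hx'
    simpa [hx'] using hx
  have key : ∫ z, f (p z) * conj (F z) ∂ν = (∫ x, f x * conj (u x) ∂μ) * conj c := by
    calc ∫ z, f (p z) * conj (F z) ∂ν = ∫ z, (f (p z) * conj (u (p z))) * conj (I z) ∂ν := by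
          refine integral_congr_ae ?_
          filter_upwards [PolyPhase.norm_eq_one hup] with z hz
          have := Complex.conj_mul_of_norm_one hz
          simp only [hI, map_mul, Complex.conj_conj]
          linear_combination -(f (p z) * conj (F z)) * this
      _ = ∫ x, (f x * conj (u x)) * conj (v x) ∂μ := (hvI _ hfuL).symm
      _ = ∫ x, (f x * conj (u x)) * conj c ∂μ := by
          refine integral_congr_ae ?_
          filter_upwards [hc] with x hx
          rw [hx]; rfl
      _ = _ := integral_mul_const _ _
  rw [key, norm_mul]
  calc _ ≤ ε * 1 := mul_le_mul (hfu u hu) hc1 (norm_nonneg _) hε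
    _ = ε := mul_one ε

/-! ### Birkhoff's pointwise ergodic theorem -/

/-- The maximum of the first `n + 1` nontrivial Birkhoff sums of `g`. -/
noncomputable def birkhoffMax {X : Type*} (T : X → X) (g : X → ℝ) : ℕ → X → ℝ
  | 0 => g
  | n + 1 => fun x => g x + max 0 (birkhoffMax T g n (T x))

lemma birkhoffMax_le_succ {X : Type*} (T : X → X) (g : X → ℝ) (n : ℕ) (x : X) :
    birkhoffMax T g n x ≤ birkhoffMax T g (n + 1) x := by
  induction n generalizing x with
  | zero => simp [birkhoffMax]
  | succ n ih =>
    have := ih (T x)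
    simp only [birkhoffMax] at this ⊢
    gcongr

lemma birkhoffSum_succ_le_birkhoffMax {X : Type*} (T : X → X) (g : X → ℝ) (n : ℕ) (x : X) :
    birkhoffSum T g (n + 1) x ≤ birkhoffMax T g n x := by
  induction n generalizing x with
  | zero => simp [birkhoffMax]
  | succ n ih =>
    rw [birkhoffSum_succ']
    simp only [birkhoffMax]
    gcongr
    exact (ih (T x)).trans (le_max_right _ _)

section

variable {X : Type*} [MeasurableSpace X] {μ : Measure X} {T : X → X}

lemma measurable_birkhoffMax (hT : Measurable T) {g : X → ℝ} (hg : Measurable g) (n : ℕ) :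
    Measurable (birkhoffMax T g n) := by
  induction n with
  | zero => exact hg
  | succ n ih => exact hg.add (measurable_const.max (ih.comp hT))

lemma integrable_birkhoffMax (hT : MeasurePreserving T μ μ) {g : X → ℝ} (hg : Integrable g μ)
    (n : ℕ) : Integrable (birkhoffMax T g n) μ := by
  induction n with
  | zero => exact hg
  | succ n ih =>
    refine hg.add (Integrable.sup (integrable_zero _ _ _) ?_)
    exact hT.integrable_comp_of_integrable ih

/-- A consequence of the maximal ergodic theorem: the Birkhoff sums of a function with negative
integral are almost everywhere bounded above. -/
lemma Ergodic.ae_exists_birkhoffSum_le [IsProbabilityMeasure μ] (hT : Ergodic T μ) {g : X → ℝ}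
    (hgm : Measurable g) (hg : Integrable g μ) (hneg : ∫ x, g x ∂μ < 0) :
    ∀ᵐ x ∂μ, ∃ B : ℝ, ∀ n : ℕ, birkhoffSum T g n x ≤ B := by
  have hTm := hT.toMeasurePreserving
  set M := birkhoffMax T g with hM
  have hMm := measurable_birkhoffMax hTm.measurable hgm
  have hMi := integrable_birkhoffMax hTm hg
  have hmono : ∀ x, Monotone fun n => M n x := fun x =>
    monotone_nat_of_le_succ fun n => birkhoffMax_le_succ T g n x
  -- the invariant set on which the maxima are unbounded
  let A : Set X := {x | ∀ B : ℕ, ∃ n, (B : ℝ) ≤ M n x}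
  have hAm : MeasurableSet A := by
    have : A = ⋂ B : ℕ, ⋃ n, {x | (B : ℝ) ≤ M n x} := by ext; simp [A]
    rw [this]
    exact MeasurableSet.iInter fun B => MeasurableSet.iUnion fun n =>
      measurableSet_le measurable_const (hMm n)
  have hAinv : T ⁻¹' A = A := by
    ext x
    simp only [Set.mem_preimage, A, Set.mem_ofPred_eq]
    constructor
    · intro h B
      obtain ⟨B', hB'⟩ := exists_nat_ge (B - g x)
      obtain ⟨n, hn⟩ := h B'
      refine ⟨n + 1, ?_⟩
      have : M (n + 1) x = g x + max 0 (M n (T x)) := rfl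
      have := le_max_right 0 (M n (T x))
      linarith
    · intro h B
      obtain ⟨B', hB'⟩ := exists_nat_ge (B + 1 + |g x|)
      obtain ⟨n, hn⟩ := h B'
      have h1 : M (n + 1) x = g x + max 0 (M n (T x)) := rfl
      have h2 : M n x ≤ M (n + 1) x := hmono x (Nat.le_succ n)
      have h3 := le_abs_self (g x)
      have hB : (0 : ℝ) ≤ B := B.cast_nonneg
      refine ⟨n, ?_⟩
      rcases max_cases 0 (M n (T x)) with ⟨h4, h5⟩ | ⟨h4, h5⟩ <;> linarith
  have hA0 : μ A = 0 := by
    rcases hT.toPreErgodic.prob_eq_zero_or_one hAm hAinv with h | h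
    · exact h
    exfalso
    have hAae : ∀ᵐ x ∂μ, x ∈ A := (prob_compl_eq_zero_iff hAm).2 h
    -- `M (n + 1) - M n ∘ T = g + max 0 (-M n ∘ T)` has nonnegative integral, while on `A` the last
    -- term vanishes in the limit
    have hlim : Tendsto (fun n => ∫ x, max 0 (-M n (T x)) ∂μ) atTop (𝓝 (∫ _, (0 : ℝ) ∂μ)) := by
      refine tendsto_integral_of_dominated_convergence (fun x => |g (T x)|) ?_ ?_ ?_ ?_
      · intro n
        exact (measurable_const.max ((hMm n).comp hTm.measurable).neg).aestronglyMeasurable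
      · exact hTm.integrable_comp_of_integrable (g := fun x => |g x|) hg.abs
      · intro n
        refine Eventually.of_forall fun x => ?_
        have h1 : M 0 (T x) ≤ M n (T x) := hmono _ (Nat.zero_le n)
        have h2 : M 0 (T x) = g (T x) := rfl
        rw [Real.norm_of_nonneg (le_max_left _ _)]
        refine max_le (abs_nonneg _) ?_
        have := neg_abs_le (g (T x))
        linarith
      · filter_upwards [hTm.quasiMeasurePreserving.ae hAae] with x hx
        obtain ⟨n, hn⟩ := hx 0
        refine tendsto_const_nhds.congr' ?_
        filter_upwards [eventually_ge_atTop n] with m hm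
        have := hmono (T x) hm
        simp only [Nat.cast_zero] at hn this
        rw [max_eq_left]
        linarith
    have hle : ∀ n, 0 ≤ ∫ x, g x ∂μ + ∫ x, max 0 (-M n (T x)) ∂μ := by
      intro n
      have hMT : Integrable (fun x => M n (T x)) μ := hTm.integrable_comp_of_integrable (hMi n)
      have i1 : Integrable (fun x => max 0 (-M n (T x))) μ :=
        Integrable.sup (integrable_zero _ _ _) hMT.neg
      calc (0 : ℝ) ≤ ∫ x, M (n + 1) x ∂μ - ∫ x, M n x ∂μ :=
            sub_nonneg.2 (integral_mono (hMi n) (hMi (n + 1)) fun x => hmono x (Nat.le_succ n))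
        _ = ∫ x, M (n + 1) x ∂μ - ∫ x, M n (T x) ∂μ := by
            rw [hTm.integral_comp_ae (hMi n).1]
        _ = ∫ x, (M (n + 1) x - M n (T x)) ∂μ := (integral_sub (hMi (n + 1)) hMT).symm
        _ = ∫ x, (g x + max 0 (-M n (T x))) ∂μ := by
            congr 1; ext x
            have h1 : M (n + 1) x = g x + max 0 (M n (T x)) := rfl
            rw [h1]
            rcases max_cases 0 (M n (T x)) with ⟨h4, h5⟩ | ⟨h4, h5⟩ <;>
            rcases max_cases 0 (-M n (T x)) with ⟨h6, h7⟩ | ⟨h6, h7⟩ <;> linarith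
        _ = _ := integral_add hg i1
    have := ge_of_tendsto' (hlim.const_add (∫ x, g x ∂μ)) hle
    simp only [integral_zero, add_zero] at this
    linarith
  have hAae : ∀ᵐ x ∂μ, x ∉ A := measure_eq_zero_iff_ae_notMem.1 hA0
  filter_upwards [hAae] with x hx
  simp only [A, Set.mem_ofPred_eq, not_forall, not_exists, not_le] at hx
  obtain ⟨B, hB⟩ := hx
  refine ⟨B, fun n => ?_⟩
  cases n with
  | zero => simp
  | succ n => exact (birkhoffSum_succ_le_birkhoffMax T g n x).trans (hB n).le

/-- One half of Birkhoff's ergodic theorem. -/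
lemma Ergodic.ae_eventually_birkhoffSum_le [IsProbabilityMeasure μ] (hT : Ergodic T μ) {g : X → ℝ}
    (hgm : Measurable g) (hg : Integrable g μ) :
    ∀ᵐ x ∂μ, ∀ ε : ℝ, 0 < ε →
      ∀ᶠ n : ℕ in atTop, birkhoffSum T g n x ≤ n * (∫ y, g y ∂μ + ε) := by
  have h : ∀ m : ℕ, ∀ᵐ x ∂μ, ∃ B : ℝ, ∀ n : ℕ,
      birkhoffSum T (fun y => g y - (∫ y, g y ∂μ + 1 / (m + 1 : ℝ))) n x ≤ B := by
    intro m
    refine hT.ae_exists_birkhoffSum_le (hgm.sub measurable_const)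
      (hg.sub (integrable_const _)) ?_
    rw [integral_sub hg (integrable_const _)]
    simp only [integral_const, probReal_univ, one_smul]
    have : (0 : ℝ) < 1 / (m + 1) := by positivity
    linarith
  filter_upwards [ae_all_iff.2 h] with x hx ε hε
  obtain ⟨m, hm⟩ := exists_nat_one_div_lt (half_pos hε)
  obtain ⟨B, hB⟩ := hx m
  obtain ⟨n₀, hn₀⟩ := exists_nat_ge (B / (ε / 2))
  filter_upwards [eventually_ge_atTop n₀] with n hn
  have h1 := hB n
  rw [birkhoffSum, Finset.sum_sub_distrib] at h1
  simp only [Finset.sum_const, Finset.card_range, nsmul_eq_mul] at h1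
  have h2 : B ≤ n * (ε / 2) := by
    rw [div_le_iff₀ (half_pos hε)] at hn₀
    have : (n₀ : ℝ) ≤ n := by exact_mod_cast hn
    nlinarith
  have h3 : (n : ℝ) * (1 / (m + 1)) ≤ n * (ε / 2) := by gcongr
  rw [birkhoffSum]
  linarith

lemma Ergodic.ae_tendsto_average_real [IsProbabilityMeasure μ] (hT : Ergodic T μ) {g : X → ℝ}
    (hg : Integrable g μ) :
    ∀ᵐ x ∂μ, Tendsto (fun N : ℕ => (1 / (N : ℝ)) * ∑ n ∈ Finset.Icc 1 N, g (T^[n] x)) atTop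
      (𝓝 (∫ y, g y ∂μ)) := by
  have hTm := hT.toMeasurePreserving
  wlog hgm : Measurable g generalizing g
  · obtain ⟨g', hg'm, hgg'⟩ := hg.1.aemeasurable
    rw [integral_congr_ae hgg']
    filter_upwards [this (hg.congr hgg') hg'm, ae_all_iff.2 fun n =>
      (hTm.iterate n).quasiMeasurePreserving.ae hgg'] with x h1 h2
    simpa only [h2] using h1
  have h1 := hT.ae_eventually_birkhoffSum_le hgm hg
  have h2 := hT.ae_eventually_birkhoffSum_le hgm.neg hg.neg
  filter_upwards [hTm.quasiMeasurePreserving.ae h1, hTm.quasiMeasurePreserving.ae h2]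
    with x hx1 hx2
  have hsum : ∀ N : ℕ, ∑ n ∈ Finset.Icc 1 N, g (T^[n] x) = birkhoffSum T g N (T x) := by
    intro N
    rw [birkhoffSum, Finset.range_eq_Ico, ← Finset.Ico_add_one_right_eq_Icc,
      Finset.sum_Ico_eq_sum_range, Nat.Ico_zero_eq_range]
    refine Finset.sum_congr (by simp) fun n _ => ?_
    rw [← Function.iterate_succ_apply, add_comm]
  rw [Metric.tendsto_nhds]
  intro ε hε
  filter_upwards [hx1 (ε / 2) (half_pos hε), hx2 (ε / 2) (half_pos hε), eventually_gt_atTop 0]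
    with N hN1 hN2 hN
  have hN' : (0 : ℝ) < N := by exact_mod_cast hN
  have hneg : birkhoffSum T (-g) N (T x) = -birkhoffSum T g N (T x) := by
    simp [birkhoffSum]
  rw [hneg] at hN2
  simp only [Pi.neg_apply, integral_neg] at hN2
  rw [hsum, Real.dist_eq, one_div, inv_mul_eq_div, abs_lt]
  constructor
  · rw [lt_sub_iff_add_lt, lt_div_iff₀ hN']
    nlinarith
  · rw [sub_lt_iff_lt_add, div_lt_iff₀ hN']
    nlinarith

/-- **Birkhoff's pointwise ergodic theorem** for an ergodic transformation. -/
theorem Ergodic.ae_tendsto_average [IsProbabilityMeasure μ] (hT : Ergodic T μ) {g : X → ℂ}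
    (hg : Integrable g μ) :
    ∀ᵐ x ∂μ, Tendsto (fun N : ℕ => (1 / (N : ℂ)) * ∑ n ∈ Finset.Icc 1 N, g (T^[n] x)) atTop
      (𝓝 (∫ y, g y ∂μ)) := by
  filter_upwards [hT.ae_tendsto_average_real hg.re, hT.ae_tendsto_average_real hg.im] with x h1 h2
  have h3 := ((Complex.continuous_ofReal.tendsto _).comp h1).add
    (((Complex.continuous_ofReal.tendsto _).comp h2).mul_const Complex.I)
  have e1 : ((∫ y, RCLike.re (g y) ∂μ : ℝ) : ℂ) + (∫ y, RCLike.im (g y) ∂μ : ℝ) * Complex.I =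
      ∫ y, g y ∂μ := integral_re_add_im hg
  rw [e1] at h3
  refine h3.congr fun N => ?_
  apply Complex.ext <;>
    simp [Complex.mul_re, Complex.mul_im, ← Complex.ofReal_natCast, ← Complex.ofReal_inv]

end

/-! ### Joinings and the Krein–Milman theorem -/

/-- A *constrained joining* over a factor map `p` of a system `(Z, R)`: an `R`-invariant
probability measure projecting to `μ`, and carried by the zero set of the function `κ`. -/
structure IsConstrainedJoining {Z W : Type*} [MeasurableSpace Z] [MeasurableSpace W] (R : Z → Z)
    (p : Z → W) (μ : Measure W) (κ : Z → ℝ) (ν : Measure Z) : Prop where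
  measurePreserving : MeasurePreserving R ν ν
  map_eq : ν.map p = μ
  ae_eq_zero : ∀ᵐ z ∂ν, κ z = 0

/-- Conditioning on an invariant set preserves joinings: the projection to an ergodic base cannot
change, being invariant and absolutely continuous. -/
lemma IsConstrainedJoining.cond {Z W : Type*} [MeasurableSpace Z] [MeasurableSpace W] {R : Z → Z}
    {T : W → W} {p : Z → W} {μ : Measure W} [IsProbabilityMeasure μ] (hT : Ergodic T μ)
    (hp : Measurable p)
    (hpR : ∀ z, p (R z) = T (p z)) {κ : Z → ℝ} {ν : Measure Z} [IsProbabilityMeasure ν]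
    (hν : IsConstrainedJoining R p μ κ ν) {s : Set Z} (hs : MeasurableSet s) (hRs : R ⁻¹' s = s)
    (hs0 : ν s ≠ 0) : IsConstrainedJoining R p μ κ (ProbabilityTheory.cond ν s) := by
  have hprob := ProbabilityTheory.cond_isProbabilityMeasure hs0
  have hac : ProbabilityTheory.cond ν s ≪ ν := ProbabilityTheory.cond_absolutelyContinuous
  have hinv : MeasurePreserving R (ProbabilityTheory.cond ν s) (ProbabilityTheory.cond ν s) := by
    refine MeasurePreserving.smul_measure ?_ _
    have := hν.1.restrict_preimage hs
    rwa [hRs] at this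
  refine ⟨hinv, ?_, ?_⟩
  · have := Measure.isProbabilityMeasure_map (μ := ProbabilityTheory.cond ν s) hp.aemeasurable
    refine hT.eq_of_absolutelyContinuous ⟨hT.measurable, ?_⟩ ?_
    · rw [Measure.map_map hT.measurable hp]
      nth_rw 2 [← hinv.map_eq]
      rw [Measure.map_map hp hinv.measurable]
      congr 1
      ext z
      exact (hpR z).symm
    · rw [← hν.2]
      exact hac.map hp
  · exact hac.ae_le hν.3

section

variable {Z W : Type*} [TopologicalSpace Z] [CompactSpace Z] [TopologicalSpace.MetrizableSpace Z]
  [MeasurableSpace Z] [BorelSpace Z]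

/-- Integration against a probability measure, as a functional on continuous functions. -/
noncomputable def integralFunctional (ν : ProbabilityMeasure Z) : WeakDual ℝ C(Z, ℝ) :=
  StrongDual.toWeakDual (LinearMap.mkContinuous
    { toFun := fun ψ => ∫ z, ψ z ∂(ν : Measure Z)
      map_add' := fun a b => integral_add
        (a.continuous.integrable_of_hasCompactSupport (HasCompactSupport.of_compactSpace _))
        (b.continuous.integrable_of_hasCompactSupport (HasCompactSupport.of_compactSpace _))
      map_smul' := fun c a => integral_const_mul c _ } 1 (fun ψ => by
        simpa using norm_integral_le_of_norm_le_const (μ := (ν : Measure Z)) (C := ‖ψ‖)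
          (Eventually.of_forall fun z => ψ.norm_coe_le_norm z)))

lemma integralFunctional_apply (ν : ProbabilityMeasure Z) (ψ : C(Z, ℝ)) :
    integralFunctional ν ψ = ∫ z, ψ z ∂(ν : Measure Z) := rfl

lemma continuous_integralFunctional :
    Continuous (integralFunctional : ProbabilityMeasure Z → WeakDual ℝ C(Z, ℝ)) := by
  refine WeakDual.continuous_of_continuous_eval fun ψ => ?_
  exact ProbabilityMeasure.continuous_integral_continuousMap ψ

lemma measure_eq_of_forall_integral_eq {Z : Type*} [TopologicalSpace Z]
    [TopologicalSpace.MetrizableSpace Z] [MeasurableSpace Z] [BorelSpace Z]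
    {ν₁ ν₂ : Measure Z} [IsFiniteMeasure ν₁] [IsFiniteMeasure ν₂] (h : ∀ ψ : C(Z, ℝ), ∫ z, ψ z ∂ν₁ = ∫ z, ψ z ∂ν₂) : ν₁ = ν₂ :=
  ext_of_forall_integral_eq_of_IsFiniteMeasure fun f => h f.toContinuousMap

variable [TopologicalSpace W] [TopologicalSpace.MetrizableSpace W]
  [MeasurableSpace W] [BorelSpace W] {R : Z → Z} {T : W → W} {p : Z → W} {μ : Measure W}

lemma isClosed_setOf_isConstrainedJoining [IsProbabilityMeasure μ] (hR : Continuous R)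
    (hp : Continuous p) {κ : C(Z, ℝ)} (hκ : ∀ z, 0 ≤ κ z) :
    IsClosed {ν : ProbabilityMeasure Z | IsConstrainedJoining R p μ κ (ν : Measure Z)} := by
  have : {ν : ProbabilityMeasure Z | IsConstrainedJoining R p μ κ (ν : Measure Z)} =
      {ν : ProbabilityMeasure Z | ν.map hR.aemeasurable = ν} ∩
        {ν : ProbabilityMeasure Z | ν.map hp.aemeasurable =
          (⟨μ, inferInstance⟩ : ProbabilityMeasure W)} ∩
        {ν : ProbabilityMeasure Z | ∫ z, κ z ∂(ν : Measure Z) = 0} := by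
    ext ν
    have hint : Integrable (fun z => κ z) (ν : Measure Z) :=
      κ.continuous.integrable_of_hasCompactSupport (HasCompactSupport.of_compactSpace _)
    have h0 : ∫ z, κ z ∂(ν : Measure Z) = 0 ↔ ∀ᵐ z ∂(ν : Measure Z), κ z = 0 :=
      integral_eq_zero_iff_of_nonneg hκ hint
    simp only [Set.mem_inter_iff, Set.mem_ofPred_eq, h0]
    exact ⟨fun h => ⟨⟨Subtype.ext h.1.map_eq, Subtype.ext h.2⟩, h.3⟩, fun h =>
      ⟨⟨hR.measurable, congrArg Subtype.val h.1.1⟩, congrArg Subtype.val h.1.2, h.2⟩⟩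
  rw [this]
  refine ((isClosed_eq (ProbabilityMeasure.continuous_map hR) continuous_id).inter
    (isClosed_eq (ProbabilityMeasure.continuous_map hp) continuous_const)).inter
    (isClosed_eq ?_ continuous_const)
  exact ProbabilityMeasure.continuous_integral_continuousMap κ

/-- A bound for the integrals of a continuous function against all ergodic constrained joinings
holds for all constrained joinings, by the Krein–Milman theorem. -/
theorem IsConstrainedJoining.norm_integral_le_of_ergodic [IsProbabilityMeasure μ]
    (hT : Ergodic T μ) (hR : Continuous R) (hp : Continuous p) (hpR : ∀ z, p (R z) = T (p z))
    {κ : C(Z, ℝ)} (hκ : ∀ z, 0 ≤ κ z) (g : C(Z, ℂ)) {ε : ℝ}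
    (h : ∀ ν : Measure Z, IsProbabilityMeasure ν → Ergodic R ν →
      IsConstrainedJoining R p μ κ ν → ‖∫ z, g z ∂ν‖ ≤ ε)
    {ν : Measure Z} [IsProbabilityMeasure ν] (hν : IsConstrainedJoining R p μ κ ν) :
    ‖∫ z, g z ∂ν‖ ≤ ε := by
  set J : Set (ProbabilityMeasure Z) := {ν | IsConstrainedJoining R p μ κ (ν : Measure Z)} with hJ
  set Q : Set (WeakDual ℝ C(Z, ℝ)) := integralFunctional '' J with hQ
  have hQc : IsCompact Q :=
    (isClosed_setOf_isConstrainedJoining hR hp hκ).isCompact.image continuous_integralFunctional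
  have hint : ∀ (ρ : Measure Z) [IsFiniteMeasure ρ] (ψ : C(Z, ℝ)), Integrable (fun z => ψ z) ρ :=
    fun ρ _ ψ =>
      ψ.continuous.integrable_of_hasCompactSupport (HasCompactSupport.of_compactSpace _)
  have hQconv : Convex ℝ Q := by
    rintro _ ⟨ν₁, h₁, rfl⟩ _ ⟨ν₂, h₂, rfl⟩ a b ha hb hab
    lift a to NNReal using ha
    lift b to NNReal using hb
    have hab' : (a : ENNReal) + b = 1 := by exact_mod_cast hab
    have hprob : IsProbabilityMeasure
        ((a : ENNReal) • (ν₁ : Measure Z) + (b : ENNReal) • (ν₂ : Measure Z)) :=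
      ⟨by simp [hab']⟩
    refine ⟨⟨_, hprob⟩, ⟨?_, ?_, ?_⟩, ?_⟩
    · refine ⟨hR.measurable, ?_⟩
      simp only [ProbabilityMeasure.coe_mk]
      rw [Measure.map_add _ _ hR.measurable, Measure.map_smul, Measure.map_smul, h₁.1.map_eq,
        h₂.1.map_eq]
    · simp only [ProbabilityMeasure.coe_mk]
      rw [Measure.map_add _ _ hp.measurable, Measure.map_smul, Measure.map_smul, h₁.2,
        h₂.2, ← add_smul, hab', one_smul]
    · simp only [ProbabilityMeasure.coe_mk]
      rw [ae_add_measure_iff]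
      exact ⟨Measure.ae_smul_measure h₁.3 _, Measure.ae_smul_measure h₂.3 _⟩
    · refine DFunLike.ext _ _ fun ψ => ?_
      have h1 : integralFunctional ⟨_, hprob⟩ ψ = _ := integralFunctional_apply ⟨_, hprob⟩ ψ
      rw [h1]
      simp only [ProbabilityMeasure.coe_mk]
      rw [integral_add_measure ((hint _ ψ).smul_measure (by simp))
        ((hint _ ψ).smul_measure (by simp)), integral_smul_measure, integral_smul_measure]
      rfl
  -- extreme points are ergodic
  have hext : ∀ ν ∈ J, integralFunctional ν ∈ Q.extremePoints ℝ → Ergodic R (ν : Measure Z) := by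
    intro ν hνJ hνe
    refine ⟨hνJ.1, ⟨fun s hs hRs => ?_⟩⟩
    by_contra H
    obtain ⟨hs0, hs0'⟩ : (ν : Measure Z) s ≠ 0 ∧ (ν : Measure Z) sᶜ ≠ 0 := by
      simpa [eventuallyConst_set, ae_iff, and_comm] using! H
    have hp1 := ProbabilityTheory.cond_isProbabilityMeasure hs0
    have hp2 := ProbabilityTheory.cond_isProbabilityMeasure hs0'
    have hc1 := hνJ.cond hT hp.measurable hpR hs hRs hs0
    have hc2 := hνJ.cond hT hp.measurable hpR hs.compl (by rw [Set.preimage_compl, hRs]) hs0'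
    have key : integralFunctional ⟨_, hp1⟩ = integralFunctional ν := by
      refine hνe.2 (Set.mem_image_of_mem _ (show ⟨_, hp1⟩ ∈ J from hc1))
        (Set.mem_image_of_mem _ (show ⟨_, hp2⟩ ∈ J from hc2))
        ⟨(ν : Measure Z).real s, (ν : Measure Z).real sᶜ, ?_, ?_, ?_, ?_⟩
      · exact ENNReal.toReal_pos hs0 (measure_ne_top _ _)
      · exact ENNReal.toReal_pos hs0' (measure_ne_top _ _)
      · exact probReal_add_probReal_compl hs
      · refine DFunLike.ext _ _ fun ψ => ?_
        have h1 : ∀ (t : Set Z), (ν : Measure Z) t ≠ 0 →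
            (ν : Measure Z).real t * ∫ z, ψ z ∂(ProbabilityTheory.cond (ν : Measure Z) t) =
              ∫ z in t, ψ z ∂(ν : Measure Z) := by
          intro t ht
          have ht' : (ν : Measure Z).real t ≠ 0 :=
            (ENNReal.toReal_pos ht (measure_ne_top _ _)).ne'
          rw [ProbabilityTheory.cond, integral_smul_measure, ENNReal.toReal_inv, smul_eq_mul,
            ← mul_assoc]
          change (ν : Measure Z).real t * ((ν : Measure Z).real t)⁻¹ * _ = _
          rw [mul_inv_cancel₀ ht', one_mul]
        have h2 := integral_add_compl hs (hint (ν : Measure Z) ψ)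
        rw [← h1 s hs0, ← h1 sᶜ hs0'] at h2
        exact h2
    have heq : ProbabilityTheory.cond (ν : Measure Z) s = ν :=
      measure_eq_of_forall_integral_eq fun ψ => DFunLike.congr_fun key ψ
    apply hs0'
    rw [← heq]
    simp [ProbabilityTheory.cond_apply, hs]
  let gre : C(Z, ℝ) := ⟨fun z => (g z).re, Complex.continuous_re.comp g.continuous⟩
  let gim : C(Z, ℝ) := ⟨fun z => (g z).im, Complex.continuous_im.comp g.continuous⟩
  have hval : ∀ ν : ProbabilityMeasure Z, ∫ z, g z ∂(ν : Measure Z) =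
      (integralFunctional ν gre : ℂ) + (integralFunctional ν gim : ℂ) * Complex.I := by
    intro ν
    have hg : Integrable (fun z => g z) (ν : Measure Z) :=
      g.continuous.integrable_of_hasCompactSupport (HasCompactSupport.of_compactSpace _)
    exact (integral_re_add_im hg).symm
  -- the desired bound cuts out a closed convex set of functionals
  set B : Set (WeakDual ℝ C(Z, ℝ)) := {ℓ | ‖(ℓ gre : ℂ) + (ℓ gim : ℂ) * Complex.I‖ ≤ ε} with hB
  have hBclosed : IsClosed B := by
    refine isClosed_le (Continuous.norm ?_) continuous_const
    exact (Complex.continuous_ofReal.comp (WeakDual.eval_continuous gre)).add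
      ((Complex.continuous_ofReal.comp (WeakDual.eval_continuous gim)).mul continuous_const)
  have hBconv : Convex ℝ B := by
    intro ℓ₁ h₁ ℓ₂ h₂ a b ha hb hab
    simp only [hB, Set.mem_ofPred_eq] at h₁ h₂ ⊢
    have e : (((a • ℓ₁ + b • ℓ₂) gre : ℝ) : ℂ) + (((a • ℓ₁ + b • ℓ₂) gim : ℝ) : ℂ) * Complex.I =
        (a : ℂ) * ((ℓ₁ gre : ℂ) + (ℓ₁ gim : ℂ) * Complex.I) +
        (b : ℂ) * ((ℓ₂ gre : ℂ) + (ℓ₂ gim : ℂ) * Complex.I) := by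
      have e1 : ∀ ψ, (a • ℓ₁ + b • ℓ₂) ψ = a * ℓ₁ ψ + b * ℓ₂ ψ := fun ψ => rfl
      rw [e1, e1]
      push_cast
      ring
    rw [e]
    calc _ ≤ a * ε + b * ε := by
          refine (norm_add_le _ _).trans (add_le_add ?_ ?_)
          · rw [norm_mul, Complex.norm_real, Real.norm_of_nonneg ha]; gcongr
          · rw [norm_mul, Complex.norm_real, Real.norm_of_nonneg hb]; gcongr
      _ = ε := by rw [← add_mul, hab, one_mul]
  have hsub : Q.extremePoints ℝ ⊆ B := by
    intro ℓ hℓ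
    obtain ⟨ν, hνJ, rfl⟩ := hℓ.1
    simp only [hB, Set.mem_ofPred_eq, ← hval]
    exact h _ inferInstance (hext ν hνJ hℓ) hνJ
  have : LocallyConvexSpace ℝ (WeakDual ℝ C(Z, ℝ)) := WeakBilin.locallyConvexSpace
  have hQB : Q ⊆ B := by
    rw [← closure_convexHull_extremePoints hQc hQconv]
    exact closure_minimal (convexHull_min hsub hBconv) hBclosed
  have hmem := hQB (Set.mem_image_of_mem _
    (show (⟨ν, inferInstance⟩ : ProbabilityMeasure Z) ∈ J from hν))
  rw [show ∫ z, g z ∂ν = _ from hval ⟨ν, inferInstance⟩]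
  exact hmem

end

/-! ### Limits of empirical measures -/

section

variable {Z W : Type*} [TopologicalSpace Z] [CompactSpace Z] [TopologicalSpace.MetrizableSpace Z]
  [MeasurableSpace Z] [BorelSpace Z]

/-- The empirical measure of the orbit segment `R z, …, R^(N+1) z`; its length is `N + 1` so that it
is a probability measure also for `N = 0`. -/
noncomputable def empiricalMeasure (R : Z → Z) (z : Z) (N : ℕ) : ProbabilityMeasure Z :=
  ⟨((N + 1 : ℕ) : ENNReal)⁻¹ • ∑ n ∈ Finset.Icc 1 (N + 1), Measure.dirac (R^[n] z), ⟨by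
    simp only [Measure.smul_apply, Measure.finsetSum_apply, measure_univ, smul_eq_mul]
    simp only [Finset.sum_const, Nat.card_Icc, nsmul_eq_mul, mul_one, Nat.add_sub_cancel]
    exact ENNReal.inv_mul_cancel (by simp) (ENNReal.natCast_ne_top _)⟩⟩

lemma integral_empiricalMeasure (R : Z → Z) (z : Z) (N : ℕ) (ψ : C(Z, ℝ)) :
    ∫ y, ψ y ∂(empiricalMeasure R z N : Measure Z) =
      (1 / ((N + 1 : ℕ) : ℝ)) * ∑ n ∈ Finset.Icc 1 (N + 1), ψ (R^[n] z) := by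
  have hint : ∀ n ∈ Finset.Icc 1 (N + 1), Integrable (fun y => ψ y) (Measure.dirac (R^[n] z)) :=
    fun n _ =>
      ψ.continuous.integrable_of_hasCompactSupport (HasCompactSupport.of_compactSpace _)
  simp only [empiricalMeasure, ProbabilityMeasure.coe_mk]
  rw [integral_smul_measure, integral_finsetSum_measure hint, ENNReal.toReal_inv,
    ENNReal.toReal_natCast, one_div, smul_eq_mul]
  simp only [integral_dirac]

variable [TopologicalSpace W] [TopologicalSpace.MetrizableSpace W]
  [MeasurableSpace W] [BorelSpace W] {R : Z → Z} {T : W → W} {p : Z → W} {μ : Measure W}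

/-- Averages of a continuous function along orbits lying over the orbit of a generic point are, up
to a small error, bounded by the integrals against constrained joinings; the bound is uniform in
the choice of the orbits. -/
theorem eventually_norm_average_le [IsProbabilityMeasure μ] (hR : Continuous R)
    (hp : Continuous p) (hpR : ∀ z, p (R z) = T (p z)) {κ : C(Z, ℝ)} (g : C(Z, ℂ)) {ε δ : ℝ}
    (hεδ : ε < δ)
    (h : ∀ ν : Measure Z, IsProbabilityMeasure ν →
      IsConstrainedJoining R p μ κ ν → ‖∫ z, g z ∂ν‖ ≤ ε) {w : W}
    (hw : ∀ ψ : C(W, ℝ), Tendsto (fun N : ℕ =>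
      (1 / (N : ℝ)) * ∑ n ∈ Finset.Icc 1 N, ψ (T^[n] w)) atTop (𝓝 (∫ y, ψ y ∂μ))) :
    ∀ᶠ N : ℕ in atTop, ∀ z : Z, p z = w → (∀ n, κ (R^[n] z) = 0) →
      ‖(1 / (N : ℂ)) * ∑ n ∈ Finset.Icc 1 N, g (R^[n] z)‖ ≤ δ := by
  suffices hsucc : ∀ᶠ N : ℕ in atTop, ∀ z : Z, p z = w → (∀ n, κ (R^[n] z) = 0) →
      ‖(1 / ((N + 1 : ℕ) : ℂ)) * ∑ n ∈ Finset.Icc 1 (N + 1), g (R^[n] z)‖ ≤ δ by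
    obtain ⟨N₀, hN₀⟩ := eventually_atTop.1 hsucc
    refine eventually_atTop.2 ⟨N₀ + 1, fun N hN => ?_⟩
    obtain ⟨M, rfl⟩ : ∃ M, N = M + 1 := ⟨N - 1, by omega⟩
    exact hN₀ M (by omega)
  by_contra hcon
  rw [not_eventually] at hcon
  set bad : Set ℕ := {N | ¬ ∀ z : Z, p z = w → (∀ n, κ (R^[n] z) = 0) →
      ‖(1 / ((N + 1 : ℕ) : ℂ)) * ∑ n ∈ Finset.Icc 1 (N + 1), g (R^[n] z)‖ ≤ δ} with hbad
  have hne : (atTop ⊓ 𝓟 bad).NeBot := frequently_mem_iff_neBot.1 hcon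
  have hZ : Nonempty Z := by
    obtain ⟨N, hN⟩ := hcon.exists
    push Not at hN
    exact ⟨hN.choose⟩
  have hchoose : ∀ N : ℕ, ∃ z : Z, N ∈ bad → p z = w ∧ (∀ n, κ (R^[n] z) = 0) ∧
      δ < ‖(1 / ((N + 1 : ℕ) : ℂ)) * ∑ n ∈ Finset.Icc 1 (N + 1), g (R^[n] z)‖ := by
    intro N
    by_cases hN : N ∈ bad
    · have hN' := hN
      simp only [hbad, Set.mem_ofPred_eq] at hN'
      push Not at hN'
      obtain ⟨z, h1, h2, h3⟩ := hN'
      exact ⟨z, fun _ => ⟨h1, h2, h3⟩⟩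
    · exact ⟨Classical.arbitrary Z, fun h => absurd h hN⟩
  choose z hz using hchoose
  -- a limit point of the empirical measures along an ultrafilter of bad times
  let U : Ultrafilter ℕ := Ultrafilter.of (atTop ⊓ 𝓟 bad)
  have hU : (U : Filter ℕ) ≤ atTop ⊓ 𝓟 bad := Ultrafilter.of_le _
  have hUtop : (U : Filter ℕ) ≤ atTop := hU.trans inf_le_left
  have hUbad : ∀ᶠ N in (U : Filter ℕ), N ∈ bad := (hU.trans inf_le_right) (mem_principal_self _)
  set E : ℕ → ProbabilityMeasure Z := fun N => empiricalMeasure R (z N) N with hE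
  obtain ⟨ν, -, hν⟩ := (isCompact_univ (X := ProbabilityMeasure Z)).ultrafilter_le_nhds
    (U.map E) (by simp)
  have hlim : Tendsto E (U : Filter ℕ) (𝓝 ν) := hν
  have hψ : ∀ ψ : C(Z, ℝ), Tendsto (fun N : ℕ =>
      (1 / ((N + 1 : ℕ) : ℝ)) * ∑ n ∈ Finset.Icc 1 (N + 1), ψ (R^[n] (z N))) (U : Filter ℕ)
      (𝓝 (∫ y, ψ y ∂(ν : Measure Z))) := by
    intro ψ
    have := ((ProbabilityMeasure.continuous_integral_continuousMap ψ).tendsto ν).comp hlim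
    refine this.congr fun N => ?_
    simp only [Function.comp_apply, hE]
    rw [integral_empiricalMeasure]
  have hpRn : ∀ n z, p (R^[n] z) = T^[n] (p z) := by
    intro n
    induction n with
    | zero => simp
    | succ n ih => intro z; rw [Function.iterate_succ_apply, ih, hpR, Function.iterate_succ_apply]
  have hinv : (ν : Measure Z).map R = ν := by
    have := Measure.isProbabilityMeasure_map (μ := (ν : Measure Z)) hR.aemeasurable
    refine measure_eq_of_forall_integral_eq fun ψ => ?_
    rw [integral_map hR.aemeasurable ψ.continuous.aestronglyMeasurable]
    refine tendsto_nhds_unique (hψ (ψ.comp ⟨R, hR⟩)) ?_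
    have h0 : Tendsto (fun N : ℕ => (1 / ((N + 1 : ℕ) : ℝ)) *
        (ψ (R^[N + 2] (z N)) - ψ (R (z N)))) (U : Filter ℕ) (𝓝 0) := by
      refine Tendsto.mono_left ?_ hUtop
      have h1 : Tendsto (fun N : ℕ => (1 / ((N + 1 : ℕ) : ℝ)) * (2 * ‖ψ‖)) atTop (𝓝 0) := by
        have := (tendsto_one_div_add_atTop_nhds_zero_nat (𝕜 := ℝ)).mul_const (2 * ‖ψ‖)
        simpa using this
      refine squeeze_zero_norm (fun N => ?_) h1
      rw [norm_mul, Real.norm_of_nonneg (by positivity)]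
      gcongr
      calc _ ≤ ‖ψ (R^[N + 2] (z N))‖ + ‖ψ (R (z N))‖ := norm_sub_le _ _
        _ ≤ ‖ψ‖ + ‖ψ‖ := add_le_add (ψ.norm_coe_le_norm _) (ψ.norm_coe_le_norm _)
        _ = 2 * ‖ψ‖ := by ring
    have h2 := (hψ ψ).add h0
    rw [add_zero] at h2
    refine h2.congr fun N => ?_
    rw [← mul_add]
    congr 1
    have e1 : ∀ M : ℕ, ∑ n ∈ Finset.Icc 1 M, ψ (R^[n] (z N)) + (ψ (R^[M + 1] (z N)) - ψ (R (z N)))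
        = ∑ n ∈ Finset.Icc 1 M, ψ (R (R^[n] (z N))) := by
      intro M
      induction M with
      | zero => simp
      | succ M ih =>
        rw [Finset.sum_Icc_succ_top (by omega), Finset.sum_Icc_succ_top (by omega), ← ih,
          Function.iterate_succ_apply' R (M + 1)]
        ring
    exact e1 (N + 1)
  have hmap : (ν : Measure Z).map p = μ := by
    have := Measure.isProbabilityMeasure_map (μ := (ν : Measure Z)) hp.aemeasurable
    refine measure_eq_of_forall_integral_eq fun ψ => ?_
    rw [integral_map hp.aemeasurable ψ.continuous.aestronglyMeasurable]
    refine tendsto_nhds_unique (hψ (ψ.comp ⟨p, hp⟩)) ?_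
    have h1 := ((hw ψ).comp (tendsto_add_atTop_nat 1)).mono_left hUtop
    refine h1.congr' ?_
    filter_upwards [hUbad] with N hN
    simp only [Function.comp_apply, ContinuousMap.comp_apply, ContinuousMap.coe_mk, hpRn,
      (hz N hN).1]
  have hκ0 : ∀ᵐ y ∂(ν : Measure Z), κ y = 0 := by
    have h1 : ∫ y, |κ y| ∂(ν : Measure Z) = 0 := by
      refine tendsto_nhds_unique (hψ ⟨fun y => |κ y|, κ.continuous.abs⟩) ?_
      refine tendsto_const_nhds.congr' ?_
      filter_upwards [hUbad] with N hN
      simp [(hz N hN).2.1]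
    have hint : Integrable (fun y => |κ y|) (ν : Measure Z) :=
      κ.continuous.abs.integrable_of_hasCompactSupport (HasCompactSupport.of_compactSpace _)
    rw [integral_eq_zero_iff_of_nonneg (fun y => abs_nonneg _) hint] at h1
    filter_upwards [h1] with y hy
    exact abs_eq_zero.1 hy
  have hJ : IsConstrainedJoining R p μ κ (ν : Measure Z) := ⟨⟨hR.measurable, hinv⟩, hmap, hκ0⟩
  have hle := h _ inferInstance hJ
  have hg : Tendsto (fun N : ℕ =>
      (1 / ((N + 1 : ℕ) : ℂ)) * ∑ n ∈ Finset.Icc 1 (N + 1), g (R^[n] (z N))) (U : Filter ℕ)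
      (𝓝 (∫ y, g y ∂(ν : Measure Z))) := by
    have h1 := hψ ⟨fun y => (g y).re, Complex.continuous_re.comp g.continuous⟩
    have h2 := hψ ⟨fun y => (g y).im, Complex.continuous_im.comp g.continuous⟩
    have h3 := ((Complex.continuous_ofReal.tendsto _).comp h1).add
      (((Complex.continuous_ofReal.tendsto _).comp h2).mul_const Complex.I)
    have hgi : Integrable (fun z => g z) (ν : Measure Z) :=
      g.continuous.integrable_of_hasCompactSupport (HasCompactSupport.of_compactSpace _)
    rw [← integral_re_add_im hgi]
    refine h3.congr fun N => ?_
    apply Complex.ext <;>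
      simp [Complex.mul_re, Complex.mul_im, ← Complex.ofReal_natCast, ← Complex.ofReal_inv,
        -Nat.cast_add]
  have hge : δ ≤ ‖∫ y, g y ∂(ν : Measure Z)‖ := by
    refine ge_of_tendsto hg.norm ?_
    filter_upwards [hUbad] with N hN
    exact (hz N hN).2.2.le
  linarith

end

/-! ### Polynomial sequences in the circle and the estimate for bounded functions -/

/-- Almost every point is generic for an ergodic measure on a compact metrizable space. -/
theorem Ergodic.ae_forall_continuous_tendsto_average {W : Type*} [TopologicalSpace W]
    [CompactSpace W] [TopologicalSpace.MetrizableSpace W] [MeasurableSpace W] [BorelSpace W]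
    {T : W → W} {μ : Measure W} [IsProbabilityMeasure μ] (hT : Ergodic T μ) :
    ∀ᵐ w ∂μ, ∀ ψ : C(W, ℝ), Tendsto (fun N : ℕ =>
      (1 / (N : ℝ)) * ∑ n ∈ Finset.Icc 1 N, ψ (T^[n] w)) atTop (𝓝 (∫ y, ψ y ∂μ)) := by
  have hint : ∀ ψ : C(W, ℝ), Integrable (fun y => ψ y) μ := fun ψ =>
    ψ.continuous.integrable_of_hasCompactSupport (HasCompactSupport.of_compactSpace _)
  have h := ae_all_iff.2 fun i : ℕ =>
    hT.ae_tendsto_average_real (hint (TopologicalSpace.denseSeq C(W, ℝ) i))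
  filter_upwards [h] with w hw ψ
  rw [Metric.tendsto_nhds]
  intro ε hε
  obtain ⟨i, hi⟩ := (TopologicalSpace.denseRange_denseSeq C(W, ℝ)).exists_dist_lt ψ
    (show 0 < ε / 3 by positivity)
  set d := TopologicalSpace.denseSeq C(W, ℝ) i with hd
  have hψd : ∀ y, ‖ψ y - d y‖ ≤ ε / 3 := fun y =>
    ((ψ - d).norm_coe_le_norm y).trans (by rw [← dist_eq_norm]; exact hi.le)
  filter_upwards [Metric.tendsto_nhds.1 (hw i) (ε / 3) (by positivity), eventually_gt_atTop 0]
    with N hN hN0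
  have hN0' : (0 : ℝ) < N := by exact_mod_cast hN0
  have h1 : ‖(1 / (N : ℝ)) * ∑ n ∈ Finset.Icc 1 N, ψ (T^[n] w) -
      (1 / (N : ℝ)) * ∑ n ∈ Finset.Icc 1 N, d (T^[n] w)‖ ≤ ε / 3 := by
    rw [← mul_sub, ← Finset.sum_sub_distrib, norm_mul, Real.norm_of_nonneg (by positivity)]
    calc _ ≤ 1 / (N : ℝ) * ∑ n ∈ Finset.Icc 1 N, ε / 3 := by
          gcongr
          exact norm_sum_le_of_le _ fun n _ => hψd _
      _ = ε / 3 := by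
          simp only [Finset.sum_const, Nat.card_Icc, Nat.add_sub_cancel, nsmul_eq_mul]
          field_simp
  have h2 : ‖∫ y, d y ∂μ - ∫ y, ψ y ∂μ‖ ≤ ε / 3 := by
    rw [← integral_sub (hint d) (hint ψ)]
    refine (norm_integral_le_of_norm_le_const (C := ε / 3)
      (Eventually.of_forall fun y => ?_)).trans (by simp)
    rw [norm_sub_rev]
    exact hψd y
  rw [dist_eq_norm] at hN ⊢
  calc _ ≤ ‖(1 / (N : ℝ)) * ∑ n ∈ Finset.Icc 1 N, ψ (T^[n] w) -
      (1 / (N : ℝ)) * ∑ n ∈ Finset.Icc 1 N, d (T^[n] w)‖ +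
      ‖(1 / (N : ℝ)) * ∑ n ∈ Finset.Icc 1 N, d (T^[n] w) - ∫ y, d y ∂μ‖ +
      ‖∫ y, d y ∂μ - ∫ y, ψ y ∂μ‖ := by
        refine le_trans (le_of_eq ?_) (norm_add₃_le)
        congr 1; ring
    _ < ε := by linarith

/-- The multiplicative forward difference of a sequence in the circle. -/
noncomputable def circleDiff (y : ℕ → Circle) : ℕ → Circle := fun n => y (n + 1) * (y n)⁻¹

/-- Differences commute with shifts. -/
lemma circleDiff_iterate_shift (j : ℕ) (y : ℕ → Circle) (m n : ℕ) :
    circleDiff^[j] (fun i => y (i + m)) n = circleDiff^[j] y (n + m) := by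
  induction j generalizing y with
  | zero => rfl
  | succ j ih =>
    rw [Function.iterate_succ_apply, Function.iterate_succ_apply, ← ih]
    have : circleDiff (fun i => y (i + m)) = fun i => circleDiff y (i + m) := by
      funext i
      simp only [circleDiff]
      rw [add_right_comm]
    rw [this]

lemma continuous_circleDiff : Continuous circleDiff :=
  continuous_pi fun n => (continuous_apply (n + 1)).mul (continuous_apply n).inv

/-- A real polynomial of degree less than `j` gives a sequence in the circle whose `j`-th
difference is trivial. -/
lemma circleDiff_iterate_toCircle_eval (j : ℕ) {Q : Polynomial ℝ} (hQ : Q.degree < j) (n : ℕ) :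
    circleDiff^[j] (fun n : ℕ => AddCircle.toCircle ((Q.eval (n : ℝ) : ℝ) : UnitAddCircle)) n = 1 := by
  induction j generalizing Q with
  | zero =>
    have : Q = 0 := by
      rw [← Polynomial.degree_eq_bot]
      exact Nat.WithBot.lt_zero_iff.1 (by simpa using hQ)
    simp [this]
  | succ j ih =>
    rw [Function.iterate_succ_apply]
    have hd : circleDiff (fun n : ℕ => AddCircle.toCircle ((Q.eval (n : ℝ) : ℝ) : UnitAddCircle)) =
        fun n : ℕ => AddCircle.toCircle
          ((((Polynomial.taylor 1 Q - Q).eval (n : ℝ) : ℝ)) : UnitAddCircle) := by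
      ext i
      simp only [circleDiff, ← AddCircle.toCircle_neg, ← AddCircle.toCircle_add]
      rw [Polynomial.eval_sub, Polynomial.taylor_eval, sub_eq_add_neg]
      push_cast
      rw [AddCircle.coe_add, AddCircle.coe_neg]
    rw [hd]
    refine ih ?_
    rcases eq_or_ne Q 0 with rfl | hQ0
    · simp
    · have h1 : (Polynomial.taylor 1 Q - Q).degree < (Polynomial.taylor 1 Q).degree :=
        Polynomial.degree_sub_lt_left (Polynomial.degree_taylor _ _)
          (by simpa using hQ0) (Polynomial.leadingCoeff_taylor _ _)
      rw [Polynomial.degree_taylor, Polynomial.degree_eq_natDegree hQ0] at h1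
      rw [Polynomial.degree_eq_natDegree hQ0] at hQ
      have hQ' : Q.natDegree < j + 1 := by exact_mod_cast hQ
      exact h1.trans_le (by exact_mod_cast Nat.lt_succ_iff.1 hQ')

/-- On an ergodic system of sequences, a coordinate in the circle with trivial difference of order
`k + 1` is a polynomial phase of degree `k`. -/
lemma PolyPhase.of_circleDiff {Z : Type*} [MeasurableSpace Z] {R : Z → Z} {ν : Measure Z}
    [IsProbabilityMeasure ν] (hR : Ergodic R ν) {q : Z → ℕ → Circle}
    (hq : ∀ j, AEStronglyMeasurable (fun z => ((circleDiff^[j] (q z) 0 : Circle) : ℂ)) ν)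
    (hqR : ∀ z n, q (R z) n = q z (n + 1)) {k : ℕ}
    (hk : ∀ᵐ z ∂ν, circleDiff^[k + 1] (q z) 0 = 1) :
    (fun z => ((q z 0 : Circle) : ℂ)) ∈ PolyPhase R ν k := by
  have hstep : ∀ j z, ((circleDiff^[j] (q (R z)) 0 : Circle) : ℂ) *
      conj ((circleDiff^[j] (q z) 0 : Circle) : ℂ) = (circleDiff^[j + 1] (q z) 0 : Circle) := by
    intro j z
    have h1 : q (R z) = fun i => q z (i + 1) := funext fun i => hqR z i
    rw [h1, circleDiff_iterate_shift, Function.iterate_succ_apply', ← Circle.coe_inv_eq_conj]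
    simp [circleDiff]
  have key : ∀ i, i ≤ k →
      (fun z => ((circleDiff^[k - i] (q z) 0 : Circle) : ℂ)) ∈ PolyPhase R ν i := by
    intro i
    induction i with
    | zero =>
      intro _
      obtain ⟨c, hc⟩ := hR.ae_eq_const_of_ae_eq_comp_ae (hq k) (by
        filter_upwards [hk] with z hz
        have h1 := hstep k z
        rw [hz] at h1
        have h2 := Complex.conj_mul_of_norm_one (Circle.norm_coe (circleDiff^[k] (q z) 0))
        simp only [Function.comp_apply]
        simp only [Circle.coe_one] at h1
        linear_combination (circleDiff^[k] (q z) 0 : ℂ) * h1 -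
          (circleDiff^[k] (q (R z)) 0 : ℂ) * h2)
      obtain ⟨z, hz⟩ := hc.exists
      refine ⟨c, ?_, hc⟩
      rw [show c = _ from hz.symm]
      exact Circle.norm_coe _
    | succ i ih =>
      intro hi
      refine ⟨hq _, Eventually.of_forall fun z => Circle.norm_coe _, ?_⟩
      simp only [hstep]
      have := ih (by omega)
      rwa [show k - i = k - (i + 1) + 1 by omega] at this
  simpa using key k le_rfl

/-- The uniform estimate for bounded functions: the averages against all polynomial sequences of
degree `k` are asymptotically bounded by the largest correlation with a polynomial phase. -/
theorem TotallyErgodic.ae_eventually_norm_average_le {X : Type*} [MeasurableSpace X]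
    {μ : Measure X} [IsProbabilityMeasure μ] {T : X → X} (hT : TotallyErgodic T μ) {f : X → ℂ}
    (hf : Measurable f) {C : ℝ} (hC : ∀ x, ‖f x‖ ≤ C) {k : ℕ} {ε : ℝ} (hε : 0 ≤ ε)
    (hfu : ∀ u ∈ PolyPhase T μ k, ‖∫ x, f x * conj (u x) ∂μ‖ ≤ ε) :
    ∀ᵐ x ∂μ, ∀ δ, ε < δ → ∀ᶠ N : ℕ in atTop, ∀ y : ℕ → Circle,
      (∀ n, circleDiff^[k + 1] y n = 1) →
      ‖(1 / (N : ℂ)) * ∑ n ∈ Finset.Icc 1 N, (y n : ℂ) * f (T^[n] x)‖ ≤ δ := by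
  have hTm : MeasurePreserving T μ μ := (hT 1 le_rfl).toMeasurePreserving
  -- the symbolic model of the system generated by `f`
  let D := Metric.closedBall (0 : ℂ) C
  have : CompactSpace D := isCompact_iff_compactSpace.1 (isCompact_closedBall _ _)
  let π : X → ℕ → D := fun x n => ⟨f (T^[n] x), by simpa [D] using hC _⟩
  have hπ : Measurable π := measurable_pi_iff.2 fun n =>
    (hf.comp (hTm.measurable.iterate n)).subtype_mk
  let σ : (ℕ → D) → (ℕ → D) := fun w n => w (n + 1)
  have hσ : Continuous σ := continuous_pi fun n => continuous_apply (n + 1)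
  have hπσ : ∀ x, π (T x) = σ (π x) := by
    intro x
    ext n
    simp only [π, σ, Function.iterate_succ_apply]
  have hπσn : ∀ n x, π (T^[n] x) = σ^[n] (π x) := by
    intro n
    induction n with
    | zero => simp
    | succ n ih => intro x; rw [Function.iterate_succ_apply, ih, hπσ, Function.iterate_succ_apply]
  let μW : Measure (ℕ → D) := μ.map π
  have : IsProbabilityMeasure μW := Measure.isProbabilityMeasure_map hπ.aemeasurable
  have hπm : MeasurePreserving π μ μW := ⟨hπ, rfl⟩
  have hσT : TotallyErgodic σ μW := fun r hr =>
    hπm.ergodic_of_ergodic_semiconj (hT r hr) (hσ.measurable.iterate r) (hπσn r)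
  let _ : MeasurableSpace Circle := borel Circle
  have : BorelSpace Circle := ⟨rfl⟩
  -- the extension by sequences in the circle
  let p : (ℕ → D × Circle) → (ℕ → D) := fun z n => (z n).1
  let R : (ℕ → D × Circle) → (ℕ → D × Circle) := fun z n => z (n + 1)
  let q : (ℕ → D × Circle) → ℕ → Circle := fun z n => (z n).2
  have hp : Continuous p := continuous_pi fun n => (continuous_apply n).fst
  have hq : Continuous q := continuous_pi fun n => (continuous_apply n).snd
  have hR : Continuous R := continuous_pi fun n => continuous_apply (n + 1)
  have hqj : ∀ j, Continuous fun z => ((circleDiff^[j] (q z) 0 : Circle) : ℂ) := fun j =>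
    continuous_subtype_val.comp
      ((continuous_apply 0).comp ((continuous_circleDiff.iterate j).comp hq))
  have hRn : ∀ n z, R^[n] z = fun i => z (i + n) := by
    intro n
    induction n with
    | zero => intro z; rfl
    | succ n ih =>
      intro z
      rw [Function.iterate_succ_apply, ih]
      funext i
      simp only [R, add_assoc]
  let κ : C(ℕ → D × Circle, ℝ) :=
    ⟨fun z => ‖((circleDiff^[k + 1] (q z) 0 : Circle) : ℂ) - 1‖,
      ((hqj (k + 1)).sub continuous_const).norm⟩
  let g : C(ℕ → D × Circle, ℂ) := ⟨fun z => ((q z 0 : Circle) : ℂ) * ((p z 0 : D) : ℂ),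
    (hqj 0).mul (continuous_subtype_val.comp ((continuous_apply 0).comp hp))⟩
  have hκ : ∀ z, κ z = ‖((circleDiff^[k + 1] (q z) 0 : Circle) : ℂ) - 1‖ := fun z => rfl
  have hg : ∀ z, g z = ((q z 0 : Circle) : ℂ) * ((p z 0 : D) : ℂ) := fun z => rfl
  have hbound : ∀ ν : Measure (ℕ → D × Circle), IsProbabilityMeasure ν →
      IsConstrainedJoining R p μW κ ν → ‖∫ z, g z ∂ν‖ ≤ ε := by
    intro ν _ hν
    refine hν.norm_integral_le_of_ergodic (hσT 1 le_rfl) hR hp (fun z => rfl)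
      (fun z => (hκ z).symm ▸ norm_nonneg _) g fun ν _ hνe hν => ?_
    have hF : (fun z => ((q z 0 : Circle) : ℂ)) ∈ PolyPhase R ν k :=
      PolyPhase.of_circleDiff hνe (fun j => (hqj j).aestronglyMeasurable) (fun z n => rfl) (by
        filter_upwards [hν.3] with z hz
        exact Subtype.ext (sub_eq_zero.1 (norm_eq_zero.1 hz)))
    have h0 : Continuous fun w : ℕ → D => ((w 0 : D) : ℂ) :=
      continuous_subtype_val.comp (continuous_apply 0)
    have := PolyPhase.norm_integral_le_of_extension (p := p) (μ := μW)
      ⟨hp.measurable, hν.map_eq⟩ hνe hσT (fun z => rfl) (PolyPhase.star_mem hF)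
      (f := fun w => ((w 0 : D) : ℂ)) h0.aestronglyMeasurable
      (C := C) (Eventually.of_forall fun w => mem_closedBall_zero_iff.1 (w 0).2) hε ?_
    · convert this using 3
      ext z
      simp [g, mul_comm]
    · intro u hu
      have h1 := hfu _ (PolyPhase.comp hπm hπσ hu)
      have h2 := hπm.integral_comp_ae (f := fun w => ((w 0 : D) : ℂ) * conj (u w))
        (h0.aestronglyMeasurable.mul (PolyPhase.aestronglyMeasurable hu).star)
      rw [← h2]
      exact h1
  filter_upwards [hπm.quasiMeasurePreserving.ae
    (hσT 1 le_rfl).ae_forall_continuous_tendsto_average] with x hx δ hδ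
  have hx' := eventually_norm_average_le hR hp (fun z => rfl) g hδ hbound (T := σ) hx
  filter_upwards [hx'] with N hN y hy
  convert hN (fun n => (π x n, y n)) rfl (fun n => ?_) using 3
  · refine Finset.sum_congr rfl fun n _ => ?_
    rw [hg, hRn]
    simp [p, q, π]
  · have h1 : q (R^[n] fun n => (π x n, y n)) = fun i => y (i + n) := by
      rw [hRn]
    rw [hκ, h1, circleDiff_iterate_shift, zero_add, hy]
    simp

/-! ### Integrable functions, continuous weights, and the equivalence -/

section

variable {X : Type*} [MeasurableSpace X] {μ : Measure X} {T : X → X}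

/-- The uniform ergodic theorem for integrable functions orthogonal to the polynomial phases. -/
theorem TotallyErgodic.ae_eventually_norm_average_le_of_orthogonal [IsProbabilityMeasure μ]
    (hT : TotallyErgodic T μ) {f : X → ℂ} (hf : Integrable f μ) {k : ℕ}
    (hfu : ∀ u ∈ PolyPhase T μ k, ∫ x, f x * conj (u x) ∂μ = 0) :
    ∀ᵐ x ∂μ, ∀ δ : ℝ, 0 < δ → ∀ᶠ N : ℕ in atTop, ∀ y : ℕ → Circle,
      (∀ n, circleDiff^[k + 1] y n = 1) →
      ‖(1 / (N : ℂ)) * ∑ n ∈ Finset.Icc 1 N, (y n : ℂ) * f (T^[n] x)‖ ≤ δ := by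
  have hm : ∀ m : ℕ, ∀ᵐ x ∂μ, ∀ᶠ N : ℕ in atTop, ∀ y : ℕ → Circle,
      (∀ n, circleDiff^[k + 1] y n = 1) →
      ‖(1 / (N : ℂ)) * ∑ n ∈ Finset.Icc 1 N, (y n : ℂ) * f (T^[n] x)‖ ≤
        4 * (1 / ((m : ℝ) + 1)) := by
    intro m
    set ε : ℝ := 1 / ((m : ℝ) + 1) with hε
    have hε0 : 0 < ε := by positivity
    -- simple functions are bounded, and are almost orthogonal to polynomial phases
    obtain ⟨g, hg, hgL⟩ := (memLp_one_iff_integrable.2 hf).exists_simpleFunc_eLpNorm_sub_lt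
      ENNReal.one_ne_top (ε := ENNReal.ofReal ε) (by simpa using hε0)
    obtain ⟨C, hC⟩ := g.exists_forall_norm_le
    have hgi : Integrable (fun x => g x) μ := memLp_one_iff_integrable.1 hgL
    have hr : Integrable (fun x => f x - g x) μ := hf.sub hgi
    have hrε : ∫ x, ‖f x - g x‖ ∂μ ≤ ε := by
      rw [integral_norm_eq_lintegral_enorm hr.1]
      refine ENNReal.toReal_le_of_le_ofReal hε0.le ?_
      rw [eLpNorm_one_eq_lintegral_enorm] at hg
      exact hg.le
    have hgu : ∀ u ∈ PolyPhase T μ k, ‖∫ x, g x * conj (u x) ∂μ‖ ≤ ε := by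
      intro u hu
      have hum := (PolyPhase.aestronglyMeasurable hu).star
      have hu1 := PolyPhase.norm_eq_one hu
      have hub : ∀ᵐ x ∂μ, ‖conj (u x)‖ ≤ 1 := hu1.mono fun x hx => by simp [hx]
      have i1 : Integrable (fun x => f x * conj (u x)) μ := hf.mul_bdd hum hub
      have i2 : Integrable (fun x => g x * conj (u x)) μ := hgi.mul_bdd hum hub
      have e : ∫ x, g x * conj (u x) ∂μ = -∫ x, (f x - g x) * conj (u x) ∂μ := by
        simp_rw [sub_mul]
        rw [integral_sub i1 i2, hfu u hu]
        ring
      rw [e, norm_neg]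
      refine (norm_integral_le_integral_norm _).trans ((le_of_eq ?_).trans hrε)
      refine integral_congr_ae ?_
      filter_upwards [hu1] with x hx
      simp [hx]
    filter_upwards [hT.ae_eventually_norm_average_le g.measurable hC hε0.le hgu,
      (hT 1 le_rfl).ae_tendsto_average_real hr.norm] with x h1 h2
    filter_upwards [h1 (2 * ε) (by linarith), h2.eventually (eventually_le_nhds
      (show ∫ x, ‖f x - g x‖ ∂μ < 2 * ε by linarith)), eventually_gt_atTop 0] with N hN1 hN2 hN0 y hy
    have e : (1 / (N : ℂ)) * ∑ n ∈ Finset.Icc 1 N, (y n : ℂ) * f (T^[n] x) =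
        (1 / (N : ℂ)) * ∑ n ∈ Finset.Icc 1 N, (y n : ℂ) * g (T^[n] x) +
        (1 / (N : ℂ)) * ∑ n ∈ Finset.Icc 1 N, (y n : ℂ) * (f (T^[n] x) - g (T^[n] x)) := by
      rw [← mul_add, ← Finset.sum_add_distrib]
      congr 2 with n
      ring
    have h3 : ‖(1 / (N : ℂ)) * ∑ n ∈ Finset.Icc 1 N, (y n : ℂ) * (f (T^[n] x) - g (T^[n] x))‖ ≤
        (1 / (N : ℝ)) * ∑ n ∈ Finset.Icc 1 N, ‖f (T^[n] x) - g (T^[n] x)‖ := by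
      rw [norm_mul, norm_div, norm_one, Complex.norm_natCast]
      gcongr
      refine norm_sum_le_of_le _ fun n _ => ?_
      rw [norm_mul, Circle.norm_coe, one_mul]
    rw [e]
    refine (norm_add_le _ _).trans ?_
    have := hN1 y hy
    simp only [Function.iterate_one] at hN2
    linarith
  filter_upwards [ae_all_iff.2 hm] with x hx δ hδ
  obtain ⟨m, hm⟩ := exists_nat_one_div_lt (show 0 < δ / 4 by positivity)
  filter_upwards [hx m] with N hN y hy
  have := hN y hy
  linarith

end

section

variable {X : Type*} {T : X → X}

lemma norm_polyAverage_le (f : X → ℂ) (φ : C(UnitAddCircle, ℂ)) (P : Polynomial ℝ) (N : ℕ)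
    (x : X) :
    ‖polyAverage T f φ P N x‖ ≤ ‖φ‖ * ((1 / (N : ℝ)) * ∑ n ∈ Finset.Icc 1 N, ‖f (T^[n] x)‖) := by
  rw [polyAverage, norm_mul, norm_div, norm_one, Complex.norm_natCast, mul_left_comm]
  refine mul_le_mul_of_nonneg_left ?_ (by positivity)
  rw [Finset.mul_sum]
  refine norm_sum_le_of_le _ fun n _ => ?_
  rw [norm_mul]
  exact mul_le_mul_of_nonneg_right (φ.norm_coe_le_norm _) (norm_nonneg _)

lemma polyAverage_add_left (f : X → ℂ) (φ ψ : C(UnitAddCircle, ℂ)) (P : Polynomial ℝ) (N : ℕ)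
    (x : X) : polyAverage T f (φ + ψ) P N x = polyAverage T f φ P N x + polyAverage T f ψ P N x := by
  simp only [polyAverage, ContinuousMap.add_apply, add_mul, Finset.sum_add_distrib, mul_add]

lemma polyAverage_smul_left (f : X → ℂ) (c : ℂ) (φ : C(UnitAddCircle, ℂ)) (P : Polynomial ℝ)
    (N : ℕ) (x : X) : polyAverage T f (c • φ) P N x = c * polyAverage T f φ P N x := by
  simp only [polyAverage, ContinuousMap.smul_apply, smul_eq_mul, mul_assoc, ← Finset.mul_sum]
  ring

/-- Uniform convergence for the characters of the circle implies uniform convergence for all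
continuous functions, since trigonometric polynomials are dense. -/
lemma eventually_norm_polyAverage_le_of_circle {f : X → ℂ} {x : X} {k : ℕ} {B : ℝ}
    (hB : ∀ N : ℕ, (1 / (N : ℝ)) * ∑ n ∈ Finset.Icc 1 N, ‖f (T^[n] x)‖ ≤ B)
    (hx : ∀ δ : ℝ, 0 < δ → ∀ᶠ N : ℕ in atTop, ∀ y : ℕ → Circle,
      (∀ n, circleDiff^[k + 1] y n = 1) →
      ‖(1 / (N : ℂ)) * ∑ n ∈ Finset.Icc 1 N, (y n : ℂ) * f (T^[n] x)‖ ≤ δ)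
    (φ : C(UnitAddCircle, ℂ)) {δ : ℝ} (hδ : 0 < δ) :
    ∀ᶠ N : ℕ in atTop, ∀ P : Polynomial ℝ, P.natDegree ≤ k → ‖polyAverage T f φ P N x‖ ≤ δ := by
  have hB0 : 0 ≤ B := le_trans (by simp) (hB 0)
  have hspan : ∀ ψ ∈ Submodule.span ℂ (Set.range (@fourier (1 : ℝ))), ∀ δ : ℝ, 0 < δ →
      ∀ᶠ N : ℕ in atTop, ∀ P : Polynomial ℝ, P.natDegree ≤ k →
        ‖polyAverage T f ψ P N x‖ ≤ δ := by
    intro ψ hψ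
    induction hψ using Submodule.span_induction with
    | mem ψ hψ =>
      obtain ⟨m, rfl⟩ := hψ
      intro δ hδ
      filter_upwards [hx δ hδ] with N hN P hP
      have hd : (Polynomial.C (m : ℝ) * P).degree < ((k + 1 : ℕ) : WithBot ℕ) :=
        Polynomial.degree_le_natDegree.trans_lt
          (Nat.cast_lt.2 (Nat.lt_succ_of_le ((Polynomial.natDegree_C_mul_le _ _).trans hP)))
      have h1 := hN _ (circleDiff_iterate_toCircle_eval (k + 1) hd)
      rw [polyAverage]
      convert h1 using 5
      rw [fourier_apply, Polynomial.eval_mul, Polynomial.eval_C, ← zsmul_eq_mul,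
        AddCircle.coe_zsmul]
    | zero =>
      intro δ hδ
      refine Eventually.of_forall fun N P _ => ?_
      simpa [polyAverage] using hδ.le
    | add a b _ _ ha hb =>
      intro δ hδ
      filter_upwards [ha (δ / 2) (by positivity), hb (δ / 2) (by positivity)] with N h1 h2 P hP
      rw [polyAverage_add_left]
      refine (norm_add_le _ _).trans ?_
      have := h1 P hP
      have := h2 P hP
      linarith
    | smul c a _ ha =>
      intro δ hδ
      filter_upwards [ha (δ / (‖c‖ + 1)) (by positivity)] with N h1 P hP
      rw [polyAverage_smul_left, norm_mul]
      calc ‖c‖ * ‖polyAverage T f a P N x‖ ≤ (‖c‖ + 1) * (δ / (‖c‖ + 1)) := by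
            gcongr
            · linarith
            · exact h1 P hP
        _ = δ := by field_simp
  have hcl : φ ∈ closure (Submodule.span ℂ (Set.range (@fourier (1 : ℝ))) :
      Set C(UnitAddCircle, ℂ)) := by
    rw [← Submodule.topologicalClosure_coe, span_fourier_closure_eq_top]
    trivial
  obtain ⟨ψ, hψ, hφψ⟩ := Metric.mem_closure_iff.1 hcl (δ / (2 * (B + 1))) (by positivity)
  filter_upwards [hspan ψ hψ (δ / 2) (by positivity)] with N hN P hP
  rw [show φ = ψ + (φ - ψ) by abel, polyAverage_add_left]
  refine (norm_add_le _ _).trans ?_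
  have h1 := hN P hP
  have h2 := norm_polyAverage_le (T := T) f (φ - ψ) P N x
  have h3 : ‖φ - ψ‖ * ((1 / (N : ℝ)) * ∑ n ∈ Finset.Icc 1 N, ‖f (T^[n] x)‖) ≤ δ / 2 := by
    calc _ ≤ δ / (2 * (B + 1)) * (B + 1) := by
          rw [← dist_eq_norm]
          gcongr
          linarith [hB N]
      _ = δ / 2 := by field_simp
  linarith

end

section

variable {X : Type*} [MeasurableSpace X] {μ : Measure X} {T : X → X}

lemma IsKoopmanEigenvalue.norm_eq_one {c : ℂ} (hT : MeasurePreserving T μ μ)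
    (hc : IsKoopmanEigenvalue T μ c) : ‖c‖ = 1 := by
  obtain ⟨g, hg, hg0, hgc⟩ := hc
  have h1 : eLpNorm (g ∘ T) 2 μ = eLpNorm g 2 μ := eLpNorm_comp_measurePreserving hg.1 hT
  have h2 : eLpNorm (g ∘ T) 2 μ = ‖c‖ₑ * eLpNorm g 2 μ := by
    rw [← eLpNorm_const_smul]
    exact eLpNorm_congr_ae hgc
  have h3 : eLpNorm g 2 μ ≠ 0 := fun h => hg0 ((eLpNorm_eq_zero_iff hg.1 (by simp)).1 h)
  have h4 : ‖c‖ₑ = 1 := by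
    rw [h1] at h2
    exact (ENNReal.mul_eq_right h3 hg.2.ne).1 h2.symm
  have := congrArg ENNReal.toReal h4
  simpa using this

/-- Eigenvalues have modulus one, so every quasi-eigenfunction is a polynomial phase. -/
lemma PolyPhase.of_mem_quasiEigenfunctions (hT : MeasurePreserving T μ μ) {k : ℕ} {g : X → ℂ}
    (hg : g ∈ quasiEigenfunctions T μ k) : g ∈ PolyPhase T μ k := by
  induction k generalizing g with
  | zero =>
    obtain ⟨c, hc, h⟩ := hg
    exact ⟨c, hc.norm_eq_one hT, h⟩
  | succ k ih => exact ⟨hg.1.1, hg.2.1, ih hg.2.2⟩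

/-- In positive degree the last derivative of a polynomial phase is an eigenvalue, the eigenfunction
being the previous derivative. -/
lemma PolyPhase.mem_quasiEigenfunctions [IsProbabilityMeasure μ] {k : ℕ} {g : X → ℂ}
    (hg : g ∈ PolyPhase T μ (k + 1)) : g ∈ quasiEigenfunctions T μ (k + 1) := by
  induction k generalizing g with
  | zero =>
    obtain ⟨c, hc1, hc⟩ := hg.2.2
    refine ⟨PolyPhase.memLp hg ⊤, hg.2.1, c, ⟨g, PolyPhase.memLp hg 2, fun h => ?_, ?_⟩, hc⟩
    · obtain ⟨x, hx, hx'⟩ := (Filter.Eventually.and h hg.2.1).exists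
      simp [hx] at hx'
    · filter_upwards [hc, hg.2.1] with x hx hx'
      have := Complex.conj_mul_of_norm_one hx'
      rw [← hx, mul_assoc, this, mul_one]
  | succ k ih => exact ⟨PolyPhase.memLp hg ⊤, hg.2.1, ih hg.2.2⟩

lemma Complex.exists_toCircle_eq {z : ℂ} (hz : ‖z‖ = 1) :
    ∃ a : ℝ, z = AddCircle.toCircle (a : UnitAddCircle) := by
  refine ⟨z.arg / (2 * Real.pi), ?_⟩
  rw [AddCircle.toCircle_apply_mk, Circle.coe_exp]
  have h := Complex.norm_mul_exp_arg_mul_I z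
  rw [hz] at h
  nth_rw 1 [← h]
  have := Real.pi_ne_zero
  rw [show 2 * Real.pi / 1 * (z.arg / (2 * Real.pi)) = z.arg by field_simp]
  simp

/-- Along almost every orbit, a polynomial phase is given by a real polynomial, written in the
basis of the binomial polynomials. -/
lemma PolyPhase.ae_exists_choose_sum (hT : MeasurePreserving T μ μ) {k : ℕ} {g : X → ℂ}
    (hg : g ∈ PolyPhase T μ k) :
    ∀ᵐ x ∂μ, ∃ a : ℕ → ℝ, ∀ n : ℕ, g (T^[n] x) = AddCircle.toCircle
      ((∑ j ∈ Finset.range (k + 1), a j * (n.choose j : ℝ) : ℝ) : UnitAddCircle) := by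
  induction k generalizing g with
  | zero =>
    obtain ⟨c, hc1, hc⟩ := hg
    obtain ⟨a, ha⟩ := Complex.exists_toCircle_eq hc1
    filter_upwards [ae_all_iff.2 fun n => (hT.iterate n).quasiMeasurePreserving.ae hc] with x hx
    exact ⟨fun _ => a, fun n => by rw [hx, ha]; simp⟩
  | succ k ih =>
    filter_upwards [ih hg.2.2, ae_all_iff.2 fun n =>
      (hT.iterate n).quasiMeasurePreserving.ae hg.2.1] with x hb h1
    obtain ⟨b, hb⟩ := hb
    obtain ⟨a₀, ha₀⟩ := Complex.exists_toCircle_eq (h1 0)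
    refine ⟨fun j => j.casesOn a₀ b, fun n => ?_⟩
    rw [Finset.sum_range_succ']
    simp only [Nat.choose_zero_right, Nat.cast_one, mul_one]
    induction n with
    | zero => simpa using ha₀
    | succ n ihn =>
      have h2 := hb n
      have h3 := Complex.conj_mul_of_norm_one (h1 n)
      have h4 : g (T^[n + 1] x) = g (T (T^[n] x)) * conj (g (T^[n] x)) * g (T^[n] x) := by
        rw [Function.iterate_succ_apply', mul_assoc, h3, mul_one]
      rw [h4, h2, ihn, ← Circle.coe_mul, ← AddCircle.toCircle_add, ← AddCircle.coe_add,
        ← add_assoc, ← Finset.sum_add_distrib]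
      simp only [Nat.choose_succ_succ, Nat.cast_add, mul_add]

/-- Combinations of binomial coefficients are values of a real polynomial. -/
lemma exists_polynomial_eval_eq_choose_sum (k : ℕ) (a : ℕ → ℝ) :
    ∃ P : Polynomial ℝ, P.natDegree ≤ k ∧
      ∀ n : ℕ, P.eval (n : ℝ) = ∑ j ∈ Finset.range (k + 1), a j * (n.choose j : ℝ) := by
  refine ⟨∑ j ∈ Finset.range (k + 1), Polynomial.C (a j / j.factorial) * descPochhammer ℝ j,
    ?_, fun n => ?_⟩
  · refine Polynomial.natDegree_sum_le_of_forall_le _ _ fun j hj => ?_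
    refine (Polynomial.natDegree_C_mul_le _ _).trans ?_
    rw [descPochhammer_natDegree]
    exact Nat.lt_succ_iff.1 (Finset.mem_range.1 hj)
  · rw [Polynomial.eval_finsetSum]
    refine Finset.sum_congr rfl fun j _ => ?_
    rw [Polynomial.eval_mul, Polynomial.eval_C, descPochhammer_eval_eq_descFactorial,
      Nat.descFactorial_eq_factorial_mul_choose]
    have : (j.factorial : ℝ) ≠ 0 := by positivity
    push_cast
    field_simp

end

theorem mainTheorem1 {X : Type*} [MeasurableSpace X] (μ : Measure X) [IsProbabilityMeasure μ]
    (T : X → X) (hT : TotallyErgodic T μ) (f : X → ℂ) (hf : Integrable f μ)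
    (k : ℕ) (hk : 1 ≤ k) :
    List.TFAE [
      OrthogonalToQuasiEigenfunctions T μ k f,
      ∀ᵐ x ∂μ, ∀ φ : C(UnitAddCircle, ℂ), ∀ P : Polynomial ℝ, P.natDegree ≤ k →
        Tendsto (fun N : ℕ => polyAverage T f φ P N x) atTop (𝓝 0),
      ∀ᵐ x ∂μ, ∀ φ : C(UnitAddCircle, ℂ),
        Tendsto (fun N : ℕ => ⨆ P : {P : Polynomial ℝ // P.natDegree ≤ k},
          ‖polyAverage T f φ P.1 N x‖) atTop (𝓝 0)] := by
  have hTm : MeasurePreserving T μ μ := (hT 1 le_rfl).toMeasurePreserving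
  have hTe : Ergodic T μ := hT 1 le_rfl
  have hne : Nonempty {P : Polynomial ℝ // P.natDegree ≤ k} := ⟨⟨0, by simp⟩⟩
  tfae_have 1 → 3 := by
    intro h
    obtain ⟨k, rfl⟩ : ∃ m, k = m + 1 := ⟨k - 1, by omega⟩
    have hfu : ∀ u ∈ PolyPhase T μ (k + 1), ∫ x, f x * conj (u x) ∂μ = 0 := fun u hu =>
      h u (PolyPhase.mem_quasiEigenfunctions hu)
    filter_upwards [hT.ae_eventually_norm_average_le_of_orthogonal hf hfu,
      hTe.ae_tendsto_average_real hf.norm] with x hx hx' φ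
    obtain ⟨B, hB⟩ := hx'.bddAbove_range
    have hB' : ∀ N : ℕ, (1 / (N : ℝ)) * ∑ n ∈ Finset.Icc 1 N, ‖f (T^[n] x)‖ ≤ B := fun N =>
      hB ⟨N, rfl⟩
    rw [Metric.tendsto_nhds]
    intro ε hε
    filter_upwards [eventually_norm_polyAverage_le_of_circle hB' hx φ (half_pos hε)] with N hN
    have h1 : ⨆ P : {P : Polynomial ℝ // P.natDegree ≤ k + 1}, ‖polyAverage T f φ P.1 N x‖ ≤
        ε / 2 := ciSup_le fun P => hN P.1 P.2
    have h0 : 0 ≤ ⨆ P : {P : Polynomial ℝ // P.natDegree ≤ k + 1}, ‖polyAverage T f φ P.1 N x‖ :=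
      Real.iSup_nonneg fun P => norm_nonneg _
    rw [Real.dist_eq, sub_zero, abs_of_nonneg h0]
    linarith
  tfae_have 3 → 2 := by
    intro h
    filter_upwards [h] with x hx φ P hP
    refine squeeze_zero_norm (fun N => ?_) (hx φ)
    refine le_ciSup (f := fun P : {P : Polynomial ℝ // P.natDegree ≤ k} =>
      ‖polyAverage T f φ P.1 N x‖)
      ⟨‖φ‖ * ((1 / (N : ℝ)) * ∑ n ∈ Finset.Icc 1 N, ‖f (T^[n] x)‖), ?_⟩ ⟨P, hP⟩
    rintro _ ⟨Q, rfl⟩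
    exact norm_polyAverage_le f φ Q.1 N x
  tfae_have 2 → 1 := by
    intro h g hg
    have hgP := PolyPhase.of_mem_quasiEigenfunctions hTm hg
    have hint : Integrable (fun x => f x * conj (g x)) μ :=
      hf.mul_bdd (c := 1) (PolyPhase.aestronglyMeasurable hgP).star
        ((PolyPhase.norm_eq_one hgP).mono fun x hx => by simp [hx])
    obtain ⟨x, h1, ⟨a, ha⟩, h3⟩ := (h.and ((PolyPhase.ae_exists_choose_sum hTm hgP).and
      (hTe.ae_tendsto_average hint))).exists
    obtain ⟨P, hP, hPa⟩ := exists_polynomial_eval_eq_choose_sum k a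
    refine tendsto_nhds_unique h3 ((h1 (fourier (-1)) P hP).congr fun N => ?_)
    rw [polyAverage]
    congr 1
    refine Finset.sum_congr rfl fun n _ => ?_
    rw [ha, hPa, fourier_neg, fourier_one, mul_comm]
  tfae_finish
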